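/- **Setting.** Let $k$ be a commutative ring, $H$ a Hopf algebra over $k$ that is finitely generated projective as a $k$-module, with comultiplication $\Delta(h)=h_{(1)}\otimes h_{(2)}$, counit $\varepsilon$ and antipode $S$, and let $A$ be a right $H$-comodule algebra, with coaction the $k$-algebra map $A\to A\otimes H$, $a\mapsto a_{[0]}\otimes a_{[1]}$ (all unadorned tensor products are over $k$). * $A\otimes H$ is an $A$-coring: $b(a\otimes h)=ba\otimes h$, $(a\otimes h)b=ab_{[0]}\otimes hb_{[1]}$, comultiplication $A\otimes H\to (A\otimes H)\otimes_A(A\otimes H)$, $a\otimes h\mapsto (a\otimes h_{(1)})\otimes_A(1\otimes h_{(2)})$, counit $a\otimes h\mapsto \varepsilon(h)a$. * For an $A$-coring $\mathcal C$ with $\Delta(c)=c_{(1)}\otimes_A c_{(2)}$, the left dual ${}^*\mathcal C={}_A\mathrm{Hom}(\mathcal C,A)$ (left $A$-linear maps) is a ring with product $(\phi*\psi)(c)=\psi(c_{(1)}\phi(c_{(2)}))$, and the right dual $\mathcal C^*=\mathrm{Hom}_A(\mathcal C,A)$ (right $A$-linear maps) is a ring with product $(\phi*\psi)(c)=\phi(\psi(c_{(1)})c_{(2)})$;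 the unit of both is the counit of $\mathcal C$. * $\#(H,A)=\mathrm{Hom}_k(H,A)$ is a ring with product $(f\cdot g)(h)=f\big(g(h_{(2)})_{[1]}h_{(1)}\big)\,g(h_{(2)})_{[0]}$ and unit $h\mapsto\varepsilon(h)1$. * $A\#H^*$ is $A\otimes H^*$, where $H^*=\mathrm{Hom}_k(H,k)$ has the convolution product, with product $(a\#h^*)(b\#g^*)=ab_{[0]}\#(h^*\leftharpoonup b_{[1]})g^*$, where $(h^*\leftharpoonup y)(h)=h^*(yh)$, and unit $1\#\varepsilon$. **Proposition.** The antipode $S$ is bijective, with $k$-linear inverse $S^{-1}$, and there are ring isomorphisms $${}^*(A\otimes H)\;\xrightarrow{\ \alpha\ }\;(A\otimes H)^*\;\xrightarrow{\ \gamma\ }\;\#(H,A)\;\xrightarrow{\ e\ }\;A\#H^*$$ such that: 1. $\gamma(\phi)(h)=\phi(1\otimes S^{-1}(h))$ and $\gamma^{-1}(\zeta)(a\otimes h)=\zeta(a_{[1]}S(h))\,a_{[0]}$; 2. $e(f)=\sum_{i=1}^n f(h_i)\#h_i^*$ for every pair of dual bases $h_i\in H$, $h_i^*\in H^*$ (that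 is, $h=\sum_i h_i^*(h)h_i$ for all $h\in H$), and $e^{-1}(a\#h^*)(h)=h^*(h)\,a$; 3. the composite isomorphism $(e\circ\gamma\circ\alpha)^{-1}:A\#H^*\to{}^*(A\otimes H)$ sends $a\#h^*$ to the map $b\otimes h\mapsto h^*\big(S^{-1}(h\,a_{[1]})\big)\,b\,a_{[0]}$. -/

import Mathlib

open scoped TensorProduct
open MulOpposite

noncomputable section

namespace HopfCoring

/-! ### Tensor products of bimodules over a (noncommutative) ring -/

section BalancedTensor

variable (A : Type*) [Ring A]
variable (M : Type*) [AddCommGroup M] [Module Aᵐᵒᵖ M]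
variable (N : Type*) [AddCommGroup N] [Module A N]

/-- The subgroup of `M ⊗_ℤ N` generated by the elements `ma ⊗ n - m ⊗ an`. -/
def balSubgroup : AddSubgroup (M ⊗[ℤ] N) :=
  AddSubgroup.closure
    {z | ∃ (m : M) (a : A) (n : N), z = (op a • m) ⊗ₜ[ℤ] n - m ⊗ₜ[ℤ] (a • n)}

/-- The tensor product `M ⊗_A N` of a right `A`-module `M` and a left `A`-module `N` over a ring
`A` that need not be commutative. Right modules are modules over `Aᵐᵒᵖ`: `ma` is `op a • m`. -/
def BalTensor : Type _ := (M ⊗[ℤ] N) ⧸ balSubgroup A M N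

instance : AddCommGroup (BalTensor A M N) :=
  inferInstanceAs (AddCommGroup ((M ⊗[ℤ] N) ⧸ balSubgroup A M N))

end BalancedTensor

namespace BalTensor

section Basic

variable {A : Type*} [Ring A]
variable {M : Type*} [AddCommGroup M] [Module Aᵐᵒᵖ M]
variable {N : Type*} [AddCommGroup N] [Module A N]
variable {P : Type*} [AddCommGroup P]

variable (A) in
/-- The quotient map `M ⊗_ℤ N → M ⊗_A N`. -/
def mk : M ⊗[ℤ] N →+ BalTensor A M N := QuotientAddGroup.mk' (balSubgroup A M N)

variable (A) in
/-- The class of `m ⊗ n` in `M ⊗_A N`. -/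
def tmul (m : M) (n : N) : BalTensor A M N := mk A (m ⊗ₜ[ℤ] n)

theorem add_tmul (m m' : M) (n : N) : tmul A (m + m') n = tmul A m n + tmul A m' n := by
  simp [tmul, TensorProduct.add_tmul]

theorem tmul_add (m : M) (n n' : N) : tmul A m (n + n') = tmul A m n + tmul A m n' := by
  simp [tmul, TensorProduct.tmul_add]

theorem zero_tmul (n : N) : tmul A (0 : M) n = 0 := by
  simp [tmul]

theorem tmul_zero (m : M) : tmul A m (0 : N) = 0 := by
  simp [tmul]

theorem op_smul_tmul (m : M) (a : A) (n : N) : tmul A (op a • m) n = tmul A m (a • n) := by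
  rw [← sub_eq_zero, tmul, tmul, ← map_sub]
  exact (QuotientAddGroup.eq_zero_iff _).2 (AddSubgroup.subset_closure ⟨m, a, n, rfl⟩)

@[elab_as_elim]
theorem induction {p : BalTensor A M N → Prop} (z : BalTensor A M N) (h0 : p 0)
    (ht : ∀ m n, p (tmul A m n)) (ha : ∀ x y, p x → p y → p (x + y)) : p z := by
  obtain ⟨z, rfl⟩ := QuotientAddGroup.mk'_surjective _ z
  induction z with
  | zero => exact h0
  | tmul m n => exact ht m n
  | add x y hx hy => exact ha _ _ hx hy

/-- A biadditive map `f` with `f (ma) n = f m (an)` induces an additive map on `M ⊗_A N`. -/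
def lift (f : M →+ N →+ P) (hf : ∀ m (a : A) n, f (op a • m) n = f m (a • n)) :
    BalTensor A M N →+ P :=
  QuotientAddGroup.lift (balSubgroup A M N)
    (TensorProduct.liftAddHom f fun r m n => by simp) <| by
      rw [balSubgroup, AddSubgroup.closure_le]
      rintro _ ⟨m, a, n, rfl⟩
      simp [hf]

@[simp]
theorem lift_tmul (f : M →+ N →+ P) (hf : ∀ m (a : A) n, f (op a • m) n = f m (a • n))
    (m : M) (n : N) : lift f hf (tmul A m n) = f m n := rfl

variable {M' : Type*} [AddCommGroup M'] [Module Aᵐᵒᵖ M']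
variable {N' : Type*} [AddCommGroup N'] [Module A N']

/-- The map `f ⊗ g : M ⊗_A N → M' ⊗_A N'` of a right linear map `f` and a left linear map `g`. -/
def map (f : M →ₗ[Aᵐᵒᵖ] M') (g : N →ₗ[A] N') : BalTensor A M N →+ BalTensor A M' N' :=
  lift
    (AddMonoidHom.mk'
      (fun m => AddMonoidHom.mk' (fun n => tmul A (f m) (g n)) fun n n' => by
        simp [tmul_add])
      fun m m' => by ext; simp [add_tmul])
    fun m a n => by simp [op_smul_tmul]

@[simp]
theorem map_tmul (f : M →ₗ[Aᵐᵒᵖ] M') (g : N →ₗ[A] N') (m : M) (n : N) :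
    map f g (tmul A m n) = tmul A (f m) (g n) := rfl

end Basic

section LeftAction

variable {A : Type*} [Ring A]
variable {M : Type*} [AddCommGroup M] [Module A M] [Module Aᵐᵒᵖ M] [SMulCommClass A Aᵐᵒᵖ M]
variable {N : Type*} [AddCommGroup N] [Module A N]

/-- Left multiplication by `a` on a bimodule `M`, as a right linear map. -/
def lmulHom (a : A) : M →ₗ[Aᵐᵒᵖ] M where
  toFun m := a • m
  map_add' := smul_add a
  map_smul' b m := smul_comm a b m

/-- `a (m ⊗ n) = am ⊗ n`. -/
instance : SMul A (BalTensor A M N) := ⟨fun a z => map (lmulHom a) LinearMap.id z⟩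

theorem smul_tmul (a : A) (m : M) (n : N) : a • tmul A m n = tmul A (a • m) n := rfl

theorem smul_add_aux (a : A) (x y : BalTensor A M N) : a • (x + y) = a • x + a • y :=
  map_add (map (lmulHom a) LinearMap.id) x y

theorem smul_zero_aux (a : A) : a • (0 : BalTensor A M N) = 0 :=
  map_zero (map (lmulHom a) LinearMap.id)

instance : Module A (BalTensor A M N) where
  one_smul z := by
    induction z using induction with
    | h0 => exact smul_zero_aux _
    | ht m n => rw [smul_tmul, one_smul]
    | ha x y hx hy => rw [smul_add_aux, hx, hy]
  mul_smul a b z := by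
    induction z using induction with
    | h0 => simp only [smul_zero_aux]
    | ht m n => simp only [smul_tmul, mul_smul]
    | ha x y hx hy => simp only [smul_add_aux, hx, hy]
  smul_zero := smul_zero_aux
  smul_add := smul_add_aux
  add_smul a b z := by
    induction z using induction with
    | h0 => simp only [smul_zero_aux, add_zero]
    | ht m n => simp only [smul_tmul, add_smul, add_tmul]
    | ha x y hx hy => simp only [smul_add_aux, hx, hy]; abel
  zero_smul z := by
    induction z using induction with
    | h0 => exact smul_zero_aux _
    | ht m n => rw [smul_tmul, zero_smul, zero_tmul]
    | ha x y hx hy => rw [smul_add_aux, hx, hy, add_zero]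

end LeftAction

section RightAction

variable {A : Type*} [Ring A]
variable {M : Type*} [AddCommGroup M] [Module Aᵐᵒᵖ M]
variable {N : Type*} [AddCommGroup N] [Module A N] [Module Aᵐᵒᵖ N] [SMulCommClass A Aᵐᵒᵖ N]

/-- Right multiplication by `a` on a bimodule `N`, as a left linear map. -/
def rmulHom (a : Aᵐᵒᵖ) : N →ₗ[A] N where
  toFun n := a • n
  map_add' := smul_add a
  map_smul' b n := (smul_comm b a n).symm

/-- `(m ⊗ n) a = m ⊗ na`. -/
instance : SMul Aᵐᵒᵖ (BalTensor A M N) := ⟨fun a z => map LinearMap.id (rmulHom a) z⟩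

theorem rsmul_tmul (a : Aᵐᵒᵖ) (m : M) (n : N) : a • tmul A m n = tmul A m (a • n) := rfl

theorem rsmul_add_aux (a : Aᵐᵒᵖ) (x y : BalTensor A M N) : a • (x + y) = a • x + a • y :=
  map_add (map LinearMap.id (rmulHom a)) x y

theorem rsmul_zero_aux (a : Aᵐᵒᵖ) : a • (0 : BalTensor A M N) = 0 :=
  map_zero (map LinearMap.id (rmulHom a))

instance : Module Aᵐᵒᵖ (BalTensor A M N) where
  one_smul z := by
    induction z using induction with
    | h0 => exact rsmul_zero_aux _
    | ht m n => rw [rsmul_tmul, one_smul]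
    | ha x y hx hy => rw [rsmul_add_aux, hx, hy]
  mul_smul a b z := by
    induction z using induction with
    | h0 => simp only [rsmul_zero_aux]
    | ht m n => simp only [rsmul_tmul, mul_smul]
    | ha x y hx hy => simp only [rsmul_add_aux, hx, hy]
  smul_zero := rsmul_zero_aux
  smul_add := rsmul_add_aux
  add_smul a b z := by
    induction z using induction with
    | h0 => simp only [rsmul_zero_aux, add_zero]
    | ht m n => simp only [rsmul_tmul, add_smul, tmul_add]
    | ha x y hx hy => simp only [rsmul_add_aux, hx, hy]; abel
  zero_smul z := by
    induction z using induction with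
    | h0 => exact rsmul_zero_aux _
    | ht m n => rw [rsmul_tmul, zero_smul, tmul_zero]
    | ha x y hx hy => rw [rsmul_add_aux, hx, hy, add_zero]

end RightAction

section Assoc

variable {A : Type*} [Ring A]
variable {M : Type*} [AddCommGroup M] [Module Aᵐᵒᵖ M]
variable {N : Type*} [AddCommGroup N] [Module A N] [Module Aᵐᵒᵖ N] [SMulCommClass A Aᵐᵒᵖ N]
variable {P : Type*} [AddCommGroup P] [Module A P]

/-- For fixed `p`, the map `M ⊗_A N → M ⊗_A (N ⊗_A P)`, `m ⊗ n ↦ m ⊗ (n ⊗ p)`. -/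
def assocAux (p : P) : BalTensor A M N →+ BalTensor A M (BalTensor A N P) :=
  map LinearMap.id
    { toFun := fun n => tmul A n p
      map_add' := fun n n' => add_tmul n n' p
      map_smul' := fun _ _ => rfl }

/-- The canonical map `(M ⊗_A N) ⊗_A P → M ⊗_A (N ⊗_A P)`, `(m ⊗ n) ⊗ p ↦ m ⊗ (n ⊗ p)`. -/
def assoc : BalTensor A (BalTensor A M N) P →+ BalTensor A M (BalTensor A N P) :=
  lift
    (AddMonoidHom.flip <| AddMonoidHom.mk' assocAux fun p p' => by
      ext z
      induction z using induction with
      | h0 => simp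
      | ht m n =>
        have h : ∀ q : P, assocAux q (tmul A m n) = tmul A m (tmul A n q) := fun _ => rfl
        simp [h, tmul_add]
      | ha x y hx hy => rw [map_add, hx, hy, map_add])
    fun z a p => by
      induction z using induction with
      | h0 => simp
      | ht m n =>
        have h : ∀ (n' : N) (q : P), assocAux q (tmul A m n') = tmul A m (tmul A n' q) :=
          fun _ _ => rfl
        simp [h, rsmul_tmul, op_smul_tmul]
      | ha x y hx hy => rw [smul_add, map_add, AddMonoidHom.add_apply, hx, hy, map_add]; rfl

@[simp]
theorem assoc_tmul (m : M) (n : N) (p : P) :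
    assoc (tmul A (tmul A m n) p) = tmul A m (tmul A n p) := rfl

end Assoc

section Contraction

variable {A : Type*} [Ring A]

variable {C : Type*} [AddCommGroup C] [Module Aᵐᵒᵖ C]
variable {M : Type*} [AddCommGroup M] [Module A M]

/-- For a left linear `φ : M → A`, the map `C ⊗_A M → C`, `c ⊗ m ↦ c φ(m)`. -/
def contractRight (φ : M →ₗ[A] A) : BalTensor A C M →+ C :=
  lift
    (AddMonoidHom.mk'
      (fun c => AddMonoidHom.mk' (fun m => op (φ m) • c) fun m m' => by simp [add_smul])
      fun c c' => by ext; simp)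
    fun c a m => by simp [mul_smul]

@[simp]
theorem contractRight_tmul (φ : M →ₗ[A] A) (c : C) (m : M) :
    contractRight φ (tmul A c m) = op (φ m) • c := rfl

theorem contractRight_add (φ ψ : M →ₗ[A] A) (z : BalTensor A C M) :
    contractRight (φ + ψ) z = contractRight φ z + contractRight ψ z := by
  induction z using BalTensor.induction with
  | h0 => simp
  | ht m n => simp [add_smul]
  | ha x y hx hy => simp only [map_add, hx, hy]; abel

theorem contractRight_zero (z : BalTensor A C M) : contractRight (0 : M →ₗ[A] A) z = 0 := by
  induction z using BalTensor.induction with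
  | h0 => simp
  | ht m n => simp
  | ha x y hx hy => simp only [map_add, hx, hy, add_zero]

variable {D : Type*} [AddCommGroup D] [Module A D]
variable {N : Type*} [AddCommGroup N] [Module Aᵐᵒᵖ N]

/-- For a right linear `φ : N → A`, the map `N ⊗_A D → D`, `n ⊗ d ↦ φ(n) d`. -/
def contractLeft (φ : N →ₗ[Aᵐᵒᵖ] A) : BalTensor A N D →+ D :=
  lift
    (AddMonoidHom.mk'
      (fun n => AddMonoidHom.mk' (fun d => φ n • d) fun d d' => by simp)
      fun n n' => by ext; simp [add_smul])
    fun n a d => by simp [mul_smul]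

@[simp]
theorem contractLeft_tmul (φ : N →ₗ[Aᵐᵒᵖ] A) (n : N) (d : D) :
    contractLeft φ (tmul A n d) = φ n • d := rfl

theorem contractLeft_add (φ ψ : N →ₗ[Aᵐᵒᵖ] A) (z : BalTensor A N D) :
    contractLeft (φ + ψ) z = contractLeft φ z + contractLeft ψ z := by
  induction z using BalTensor.induction with
  | h0 => simp
  | ht m n => simp [add_smul]
  | ha x y hx hy => simp only [map_add, hx, hy]; abel

theorem contractLeft_zero (z : BalTensor A N D) : contractLeft (0 : N →ₗ[Aᵐᵒᵖ] A) z = 0 := by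
  induction z using BalTensor.induction with
  | h0 => simp
  | ht m n => simp
  | ha x y hx hy => simp only [map_add, hx, hy, add_zero]

end Contraction

section ContractionLinear

variable {A : Type*} [Ring A]
variable {C : Type*} [AddCommGroup C] [Module A C] [Module Aᵐᵒᵖ C] [SMulCommClass A Aᵐᵒᵖ C]

/-- `contractRight φ` as a left linear map. -/
def contractRightₗ (φ : C →ₗ[A] A) : BalTensor A C C →ₗ[A] C where
  toFun := contractRight φ
  map_add' := map_add _
  map_smul' a z := by
    induction z using BalTensor.induction with
    | h0 => simp
    | ht m n => simp [BalTensor.smul_tmul, smul_comm]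
    | ha x y hx hy =>
      simp only [RingHom.id_apply] at hx hy ⊢
      rw [smul_add, map_add, hx, hy, map_add, smul_add]

/-- `contractLeft φ` as a right linear map. -/
def contractLeftₗ (φ : C →ₗ[Aᵐᵒᵖ] A) : BalTensor A C C →ₗ[Aᵐᵒᵖ] C where
  toFun := contractLeft φ
  map_add' := map_add _
  map_smul' a z := by
    induction z using BalTensor.induction with
    | h0 => simp
    | ht m n => simp [BalTensor.rsmul_tmul, smul_comm]
    | ha x y hx hy =>
      simp only [RingHom.id_apply] at hx hy ⊢
      rw [smul_add, map_add, hx, hy, map_add, smul_add]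

end ContractionLinear

end BalTensor

/-! ### Corings and their dual rings -/

open BalTensor

/-- An `A`-coring: an `A`-bimodule `C` with `A`-bimodule maps `Δ : C → C ⊗_A C` and `ε : C → A`
that are coassociative and counital. -/
class Coring (A : Type*) [Ring A] (C : Type*) [AddCommGroup C] [Module A C] [Module Aᵐᵒᵖ C]
    [SMulCommClass A Aᵐᵒᵖ C] where
  /-- The comultiplication, as a left linear map. -/
  comul : C →ₗ[A] BalTensor A C C
  /-- The same map, as a right linear map. -/
  comulR : C →ₗ[Aᵐᵒᵖ] BalTensor A C C
  comulR_eq : ∀ c, comulR c = comul c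
  /-- The counit, as a left linear map. -/
  counit : C →ₗ[A] A
  /-- The same map, as a right linear map. -/
  counitR : C →ₗ[Aᵐᵒᵖ] A
  counitR_eq : ∀ c, counitR c = counit c
  coassoc : ∀ c, assoc (map comulR LinearMap.id (comul c)) = map LinearMap.id comul (comul c)
  /-- `ε(c₁) c₂ = c` -/
  counit_left : ∀ c, contractLeft counitR (comul c) = c
  /-- `c₁ ε(c₂) = c` -/
  counit_right : ∀ c, contractRight counit (comul c) = c

/-- The left dual `*C` of a bimodule: the left `A`-linear maps `C → A`. -/
@[ext]
structure LeftDual (A : Type*) [Ring A] (C : Type*) [AddCommGroup C] [Module A C] where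
  /-- The underlying left linear map. -/
  toLin : C →ₗ[A] A

/-- The right dual `C*` of a bimodule: the right `A`-linear maps `C → A`. -/
@[ext]
structure RightDual (A : Type*) [Ring A] (C : Type*) [AddCommGroup C] [Module Aᵐᵒᵖ C] where
  /-- The underlying right linear map. -/
  toLin : C →ₗ[Aᵐᵒᵖ] A

namespace LeftDual

section Additive

variable {A : Type*} [Ring A] {C : Type*} [AddCommGroup C] [Module A C]

/-- The bijection between `*C` and the left linear maps `C → A`. -/
def equiv : LeftDual A C ≃ (C →ₗ[A] A) := ⟨toLin, mk, fun _ => rfl, fun _ => rfl⟩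

instance : AddCommGroup (LeftDual A C) := equiv.addCommGroup

instance : CoeFun (LeftDual A C) (fun _ => C → A) := ⟨fun φ => φ.toLin⟩

theorem ext' {φ ψ : LeftDual A C} (h : ∀ c, φ c = ψ c) : φ = ψ :=
  LeftDual.ext (LinearMap.ext h)

theorem toLin_add (φ ψ : LeftDual A C) : (φ + ψ).toLin = φ.toLin + ψ.toLin := rfl

theorem toLin_zero : (0 : LeftDual A C).toLin = 0 := rfl

end Additive

variable {A : Type*} [Ring A] {C : Type*} [AddCommGroup C] [Module A C] [Module Aᵐᵒᵖ C]
variable [SMulCommClass A Aᵐᵒᵖ C] [Coring A C]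

/-- `(φ * ψ)(c) = ψ(c₁ φ(c₂))` -/
instance : Mul (LeftDual A C) where
  mul φ ψ := ⟨ψ.toLin ∘ₗ contractRightₗ φ.toLin ∘ₗ Coring.comul⟩

/-- The unit is the counit of `C`. -/
instance : One (LeftDual A C) where
  one := ⟨Coring.counit⟩

theorem mul_apply (φ ψ : LeftDual A C) (c : C) :
    (φ * ψ) c = ψ (contractRight φ.toLin (Coring.comul c)) := rfl

theorem one_apply (c : C) : (1 : LeftDual A C) c = Coring.counit c := rfl

theorem one_mul' (φ : LeftDual A C) : 1 * φ = φ :=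
  ext' fun c => congrArg φ.toLin (Coring.counit_right c)

theorem mul_one' (φ : LeftDual A C) : φ * 1 = φ := by
  refine ext' fun c => ?_
  rw [mul_apply, one_apply]
  conv_rhs => rw [← Coring.counit_left (A := A) c]
  generalize (Coring.comul c : BalTensor A C C) = z
  induction z using BalTensor.induction with
  | h0 => simp
  | ht m n =>
    rw [contractRight_tmul, contractLeft_tmul, ← Coring.counitR_eq]
    simp [Coring.counitR_eq]
  | ha x y hx hy => simp only [map_add, hx, hy]

theorem mul_assoc' (φ ψ χ : LeftDual A C) : φ * ψ * χ = φ * (ψ * χ) := by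
  refine ext' fun c => ?_
  simp only [mul_apply]
  have h1 : ∀ z : BalTensor A C C, (contractRight (φ * ψ).toLin z : C) =
      contractRight ψ.toLin
        (map LinearMap.id (contractRightₗ φ.toLin) (map LinearMap.id Coring.comul z)) := by
    intro z
    induction z using BalTensor.induction with
    | h0 => simp
    | ht m n => rfl
    | ha x y hx hy => simp only [map_add, hx, hy]
  have h2 : ∀ (n : C) (w : BalTensor A C C),
      (contractRight ψ.toLin (op (φ n) • w) : C) = contractRight ψ.toLin
        (map LinearMap.id (contractRightₗ φ.toLin) (assoc (tmul A w n))) := by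
    intro n w
    induction w using BalTensor.induction with
    | h0 => simp [BalTensor.zero_tmul]
    | ht m n => rfl
    | ha x y hx hy => simp only [smul_add, map_add, BalTensor.add_tmul, hx, hy]
  have h3 : ∀ z : BalTensor A C C,
      (contractRight ψ.toLin (Coring.comul (contractRight φ.toLin z)) : C) =
      contractRight ψ.toLin (map LinearMap.id (contractRightₗ φ.toLin)
        (assoc (map Coring.comulR LinearMap.id z))) := by
    intro z
    induction z using BalTensor.induction with
    | h0 => simp
    | ht m n =>
      rw [contractRight_tmul, ← Coring.comulR_eq, map_smul, h2]; rfl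
    | ha x y hx hy => simp only [map_add, hx, hy]
  rw [h1, ← Coring.coassoc]
  exact congrArg χ.toLin (h3 _).symm

instance : Ring (LeftDual A C) where
  left_distrib _ _ _ := rfl
  right_distrib φ ψ χ := ext' fun c => by
    simp only [mul_apply, toLin_add, contractRight_add, map_add, LinearMap.add_apply]
  zero_mul φ := ext' fun c => by
    simp [mul_apply, toLin_zero, contractRight_zero]
  mul_zero _ := rfl
  one_mul := one_mul'
  mul_one := mul_one'
  mul_assoc := mul_assoc'
  zsmul := zsmulRec
  neg_add_cancel := neg_add_cancel
  sub_eq_add_neg := sub_eq_add_neg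

end LeftDual

namespace RightDual

section Additive

variable {A : Type*} [Ring A] {C : Type*} [AddCommGroup C] [Module Aᵐᵒᵖ C]

/-- The bijection between `C*` and the right linear maps `C → A`. -/
def equiv : RightDual A C ≃ (C →ₗ[Aᵐᵒᵖ] A) := ⟨toLin, mk, fun _ => rfl, fun _ => rfl⟩

instance : AddCommGroup (RightDual A C) := equiv.addCommGroup

instance : CoeFun (RightDual A C) (fun _ => C → A) := ⟨fun φ => φ.toLin⟩

theorem ext' {φ ψ : RightDual A C} (h : ∀ c, φ c = ψ c) : φ = ψ :=
  RightDual.ext (LinearMap.ext h)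

theorem toLin_add (φ ψ : RightDual A C) : (φ + ψ).toLin = φ.toLin + ψ.toLin := rfl

theorem toLin_zero : (0 : RightDual A C).toLin = 0 := rfl

end Additive

variable {A : Type*} [Ring A] {C : Type*} [AddCommGroup C] [Module A C] [Module Aᵐᵒᵖ C]
variable [SMulCommClass A Aᵐᵒᵖ C] [Coring A C]

/-- `(φ * ψ)(c) = φ(ψ(c₁) c₂)` -/
instance : Mul (RightDual A C) where
  mul φ ψ := ⟨φ.toLin ∘ₗ contractLeftₗ ψ.toLin ∘ₗ Coring.comulR⟩

/-- The unit is the counit of `C`. -/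
instance : One (RightDual A C) where
  one := ⟨Coring.counitR⟩

theorem mul_apply (φ ψ : RightDual A C) (c : C) :
    (φ * ψ) c = φ (contractLeft ψ.toLin (Coring.comul c)) :=
  congrArg (fun z => φ (contractLeft ψ.toLin z)) (Coring.comulR_eq c)

theorem one_apply (c : C) : (1 : RightDual A C) c = Coring.counit c := Coring.counitR_eq c

theorem mul_one' (φ : RightDual A C) : φ * 1 = φ :=
  ext' fun c => (mul_apply φ 1 c).trans (congrArg φ.toLin (Coring.counit_left c))

theorem one_mul' (φ : RightDual A C) : 1 * φ = φ := by
  refine ext' fun c => ?_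
  rw [mul_apply, one_apply]
  conv_rhs => rw [← Coring.counit_right (A := A) c]
  generalize (Coring.comul c : BalTensor A C C) = z
  induction z using BalTensor.induction with
  | h0 => simp
  | ht m n =>
    rw [contractRight_tmul, contractLeft_tmul]
    simp
  | ha x y hx hy => simp only [map_add, hx, hy]

theorem mul_assoc' (φ ψ χ : RightDual A C) : φ * ψ * χ = φ * (ψ * χ) := by
  refine ext' fun c => ?_
  simp only [mul_apply]
  have h1 : ∀ z : BalTensor A C C, (contractLeft (ψ * χ).toLin z : C) =
      contractLeft ψ.toLin
        (map (contractLeftₗ χ.toLin) LinearMap.id (map Coring.comulR LinearMap.id z)) := by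
    intro z
    induction z using BalTensor.induction with
    | h0 => simp
    | ht m n => rfl
    | ha x y hx hy => simp only [map_add, hx, hy]
  have h2 : ∀ (w : BalTensor A (BalTensor A C C) C),
      (contractLeft ψ.toLin (map (contractLeftₗ χ.toLin) LinearMap.id w) : C) =
      contractLeft ψ.toLin (contractLeft χ.toLin (assoc w)) := by
    intro w
    induction w using BalTensor.induction with
    | h0 => simp
    | ht m n =>
      induction m using BalTensor.induction with
      | h0 => simp [BalTensor.zero_tmul]
      | ht m m' =>
        simp only [BalTensor.map_tmul, BalTensor.assoc_tmul, contractLeft_tmul, BalTensor.smul_tmul]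
        rfl
      | ha x y hx hy => simp only [map_add, BalTensor.add_tmul, hx, hy]
    | ha x y hx hy => simp only [map_add, hx, hy]
  have h3 : ∀ z : BalTensor A C C,
      (Coring.comul (contractLeft χ.toLin z) : BalTensor A C C) =
      contractLeft χ.toLin (map LinearMap.id Coring.comul z) := by
    intro z
    induction z using BalTensor.induction with
    | h0 => simp
    | ht m n => simp
    | ha x y hx hy => simp only [map_add, hx, hy]
  rw [h1, h2, Coring.coassoc, h3]

instance : Ring (RightDual A C) where
  right_distrib _ _ _ := rfl
  left_distrib φ ψ χ := ext' fun c => by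
    simp only [mul_apply, toLin_add, contractLeft_add, map_add, LinearMap.add_apply]
  mul_zero φ := ext' fun c => by
    simp [mul_apply, toLin_zero, contractLeft_zero]
  zero_mul _ := rfl
  one_mul := one_mul'
  mul_one := mul_one'
  mul_assoc := mul_assoc'
  zsmul := zsmulRec
  neg_add_cancel := neg_add_cancel
  sub_eq_add_neg := sub_eq_add_neg

end RightDual

/-! ### Comodule algebras -/

open Coalgebra (comul counit)

/-- A right `H`-comodule algebra: a `k`-algebra `A` with a coassociative and counital coaction
`A → A ⊗ H`, `a ↦ a₀ ⊗ a₁`, that is an algebra map. -/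
class ComoduleAlgebra (k H A : Type*) [CommRing k] [Ring H] [Bialgebra k H] [Ring A]
    [Algebra k A] where
  /-- The coaction `a ↦ a₀ ⊗ a₁`. -/
  coact : A →ₐ[k] A ⊗[k] H
  coassoc : ∀ a, TensorProduct.assoc k A H H (coact.toLinearMap.rTensor H (coact a)) =
    (comul : H →ₗ[k] H ⊗[k] H).lTensor A (coact a)
  counit_coact : ∀ a, TensorProduct.rid k A ((counit : H →ₗ[k] k).lTensor A (coact a)) = a

section

variable (k H A : Type*) [CommRing k] [Ring H] [Bialgebra k H] [Ring A] [Algebra k A]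

/-- The coaction `A → A ⊗ H`, `a ↦ a₀ ⊗ a₁`. -/
def coact [ComoduleAlgebra k H A] : A →ₐ[k] A ⊗[k] H := ComoduleAlgebra.coact

/-- The `k`-module `A ⊗ H` that carries the `A`-coring of a comodule algebra. -/
def TensorCoring : Type _ := A ⊗[k] H

end

variable {k H A : Type*} [CommRing k] [Ring H] [Bialgebra k H] [Ring A] [Algebra k A]

theorem smul_eq_tmul_mul (a : A) (x : A ⊗[k] H) : a • x = (a ⊗ₜ[k] (1 : H)) * x := by
  induction x with
  | zero => simp
  | tmul b h => simp [TensorProduct.smul_tmul']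
  | add x y hx hy => rw [smul_add, hx, hy, mul_add]

namespace TensorCoring

instance : AddCommGroup (TensorCoring k H A) := inferInstanceAs (AddCommGroup (A ⊗[k] H))

/-- `a (b ⊗ h) = ab ⊗ h`. -/
instance : Module A (TensorCoring k H A) := inferInstanceAs (Module A (A ⊗[k] H))

/-- The identification of the coring with `A ⊗ H` as a left `A`-module. -/
def of : A ⊗[k] H ≃ₗ[A] TensorCoring k H A := LinearEquiv.refl A (A ⊗[k] H)

/-- The element `a ⊗ h` of the coring. -/
def tmul (a : A) (h : H) : TensorCoring k H A := of (a ⊗ₜ[k] h)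

theorem exists_of (x : TensorCoring k H A) : ∃ y, of y = x := ⟨of.symm x, by simp⟩

theorem lTensor_comul_mul (x y : A ⊗[k] H) :
    (comul : H →ₗ[k] H ⊗[k] H).lTensor A (x * y) =
      (comul : H →ₗ[k] H ⊗[k] H).lTensor A x * (comul : H →ₗ[k] H ⊗[k] H).lTensor A y :=
  map_mul (Algebra.TensorProduct.map (AlgHom.id k A) (Bialgebra.comulAlgHom k H)) x y

/-- `a ⊗ h ↦ ε(h) a` -/
def counitHom : TensorCoring k H A →+ A :=
  (TensorProduct.rid k A).toLinearMap.toAddMonoidHom.comp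
    (((counit : H →ₗ[k] k).lTensor A).toAddMonoidHom.comp of.symm.toAddMonoidHom)

theorem counitHom_tmul (a : A) (h : H) :
    counitHom (tmul a h : TensorCoring k H A) = counit (R := k) h • a := rfl

theorem counitHom_mul (x y : A ⊗[k] H) :
    counitHom (of (x * y) : TensorCoring k H A) =
      counitHom (of x : TensorCoring k H A) * counitHom (of y : TensorCoring k H A) :=
  map_mul ((Algebra.TensorProduct.rid k k A).toAlgHom.comp
    (Algebra.TensorProduct.map (AlgHom.id k A) (Bialgebra.counitAlgHom k H))) x y

variable [ComoduleAlgebra k H A]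

/-- `(a ⊗ h) b = a b₀ ⊗ h b₁`, the product of `a ⊗ h` and the coaction of `b` in the algebra
`A ⊗ H`. -/
instance : SMul Aᵐᵒᵖ (TensorCoring k H A) :=
  ⟨fun b x => of (of.symm x * coact k H A b.unop)⟩

theorem op_smul_of (b : Aᵐᵒᵖ) (x : A ⊗[k] H) :
    b • (of x : TensorCoring k H A) = of (x * coact k H A b.unop) := rfl

instance : Module Aᵐᵒᵖ (TensorCoring k H A) where
  one_smul x := by
    obtain ⟨x, rfl⟩ := exists_of x
    simp [op_smul_of]
  mul_smul a b x := by
    obtain ⟨x, rfl⟩ := exists_of x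
    simp [op_smul_of, mul_assoc]
  smul_zero a := by
    rw [← map_zero of, op_smul_of, zero_mul]
  smul_add a x y := by
    obtain ⟨x, rfl⟩ := exists_of x
    obtain ⟨y, rfl⟩ := exists_of y
    rw [← map_add, op_smul_of, add_mul, map_add]; rfl
  add_smul a b x := by
    obtain ⟨x, rfl⟩ := exists_of x
    simp [op_smul_of, mul_add]
  zero_smul x := by
    obtain ⟨x, rfl⟩ := exists_of x
    simp [op_smul_of]

instance : SMulCommClass A Aᵐᵒᵖ (TensorCoring k H A) where
  smul_comm a b x := by
    obtain ⟨x, rfl⟩ := exists_of x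
    rw [op_smul_of, ← map_smul, ← map_smul, op_smul_of, smul_eq_tmul_mul, smul_eq_tmul_mul,
      mul_assoc]

theorem op_algebraMap_smul (r : k) (x : A ⊗[k] H) :
    op (algebraMap k A r) • (of x : TensorCoring k H A) = of (r • x) := by
  rw [op_smul_of, unop_op, AlgHom.commutes, ← Algebra.commutes, Algebra.smul_def]

/-- The map `(A ⊗ H) ⊗ H → (A ⊗ H) ⊗_A (A ⊗ H)`, `(a ⊗ x) ⊗ y ↦ (a ⊗ x) ⊗ (1 ⊗ y)`. -/
def insertAux :
    (A ⊗[k] H) ⊗[k] H →+ BalTensor A (TensorCoring k H A) (TensorCoring k H A) :=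
  TensorProduct.liftAddHom
    (AddMonoidHom.mk'
      (fun z => AddMonoidHom.mk' (fun y => BalTensor.tmul A (of z) (tmul 1 y)) fun y y' => by
        simp [tmul, TensorProduct.tmul_add, BalTensor.tmul_add])
      fun z z' => AddMonoidHom.ext fun y =>
        (congrArg (fun w => BalTensor.tmul A w (tmul 1 y)) (map_add of z z')).trans
          (BalTensor.add_tmul _ _ _))
    fun r z y => by
      change BalTensor.tmul A (of (r • z)) (tmul 1 y) = BalTensor.tmul A (of z) (tmul 1 (r • y))
      rw [← op_algebraMap_smul, op_smul_tmul, tmul, ← map_smul, algebraMap_smul, tmul,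
        TensorProduct.tmul_smul]

/-- The map `A ⊗ (H ⊗ H) → (A ⊗ H) ⊗_A (A ⊗ H)`, `a ⊗ (x ⊗ y) ↦ (a ⊗ x) ⊗ (1 ⊗ y)`. -/
def insert :
    A ⊗[k] (H ⊗[k] H) →+ BalTensor A (TensorCoring k H A) (TensorCoring k H A) :=
  insertAux.comp (TensorProduct.assoc k A H H).symm.toLinearMap.toAddMonoidHom

theorem insert_tmul (a : A) (x y : H) :
    insert (a ⊗ₜ[k] (x ⊗ₜ[k] y)) = BalTensor.tmul A (tmul a x) (tmul 1 y) := rfl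

/-- `a ⊗ h ↦ (a ⊗ h₁) ⊗ (1 ⊗ h₂)` -/
def comulHom :
    TensorCoring k H A →+ BalTensor A (TensorCoring k H A) (TensorCoring k H A) :=
  insert.comp (((comul : H →ₗ[k] H ⊗[k] H).lTensor A).toAddMonoidHom.comp of.symm.toAddMonoidHom)

theorem comulHom_of (x : A ⊗[k] H) :
    comulHom (of x : TensorCoring k H A) = insert ((comul : H →ₗ[k] H ⊗[k] H).lTensor A x) := rfl

theorem insert_smul (a : A) (x : A ⊗[k] (H ⊗[k] H)) : insert (a • x) = a • insert x := by
  induction x with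
  | zero => simp
  | tmul b w =>
    induction w with
    | zero => simp
    | tmul x y =>
      rw [TensorProduct.smul_tmul', insert_tmul, insert_tmul, BalTensor.smul_tmul]; rfl
    | add x y hx hy => rw [TensorProduct.tmul_add, smul_add, map_add, hx, hy, map_add, smul_add]
  | add x y hx hy => rw [smul_add, map_add, hx, hy, map_add, smul_add]

theorem insert_mul_aux (a : A) (x y : H) (w : A ⊗[k] H) :
    insert ((a ⊗ₜ[k] (x ⊗ₜ[k] y)) *
      TensorProduct.assoc k A H H ((coact k H A).toLinearMap.rTensor H w)) =
    BalTensor.tmul A (tmul a x) (of (((1 : A) ⊗ₜ[k] y) * w)) := by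
  induction w with
  | zero => simp [BalTensor.tmul_zero]
  | tmul c d =>
    have h : ∀ v : A ⊗[k] H, insert ((a ⊗ₜ[k] (x ⊗ₜ[k] y)) *
        TensorProduct.assoc k A H H (v ⊗ₜ[k] d)) =
        BalTensor.tmul A (of ((a ⊗ₜ[k] x) * v)) (tmul 1 (y * d)) := by
      intro v
      induction v with
      | zero => simp [BalTensor.zero_tmul]
      | tmul b z => simp [insert_tmul, tmul]
      | add v v' hv hv' =>
        rw [TensorProduct.add_tmul, map_add, mul_add, map_add, hv, hv', mul_add, map_add,
          BalTensor.add_tmul]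
    rw [LinearMap.rTensor_tmul, h]
    have h2 : (of ((a ⊗ₜ[k] x) * (coact k H A).toLinearMap c) : TensorCoring k H A) =
        op c • tmul a x := rfl
    rw [h2, op_smul_tmul]
    simp [tmul, ← map_smul, TensorProduct.smul_tmul']
  | add w w' hw hw' => rw [map_add, map_add, mul_add, map_add, hw, hw', mul_add, map_add,
      BalTensor.tmul_add]

theorem insert_mul (b : A) (x : A ⊗[k] (H ⊗[k] H)) :
    insert (x * (comul : H →ₗ[k] H ⊗[k] H).lTensor A (coact k H A b)) = op b • insert x := by
  have hb := ComoduleAlgebra.coassoc (k := k) (H := H) b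
  change TensorProduct.assoc k A H H
    ((coact k H A).toLinearMap.rTensor H (coact k H A b)) = _ at hb
  change insert (x * (comul : H →ₗ[k] H ⊗[k] H).lTensor A (ComoduleAlgebra.coact b)) = _
  rw [← hb]
  induction x with
  | zero => simp
  | tmul a w =>
    induction w with
    | zero => simp
    | tmul x y => rw [insert_mul_aux, insert_tmul, BalTensor.rsmul_tmul]; rfl
    | add x y hx hy => rw [TensorProduct.tmul_add, add_mul, map_add, hx, hy, map_add, smul_add]
  | add x y hx hy => rw [add_mul, map_add, hx, hy, map_add, smul_add]

theorem counitHom_coact (a : A) :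
    counitHom (of (coact k H A a) : TensorCoring k H A) = a :=
  ComoduleAlgebra.counit_coact a

/-- The map `H ⊗ (H ⊗ H) → C ⊗_A (C ⊗_A C)`, `x ⊗ w ↦ (a ⊗ x) ⊗ (1 ⊗ w)`, for `C = A ⊗ H`. -/
def insertThree (a : A) : H ⊗[k] (H ⊗[k] H) →+ BalTensor A (TensorCoring k H A)
    (BalTensor A (TensorCoring k H A) (TensorCoring k H A)) :=
  TensorProduct.liftAddHom
    (AddMonoidHom.mk'
      (fun x => AddMonoidHom.mk' (fun w => BalTensor.tmul A (tmul a x) (insert (1 ⊗ₜ[k] w)))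
        fun w w' => by simp [TensorProduct.tmul_add, BalTensor.tmul_add])
      fun x x' => by ext; simp [tmul, TensorProduct.tmul_add, BalTensor.add_tmul])
    fun r x w => by
      change BalTensor.tmul A (tmul a (r • x)) (insert (1 ⊗ₜ[k] w)) =
        BalTensor.tmul A (tmul a x) (insert (1 ⊗ₜ[k] (r • w)))
      rw [tmul, TensorProduct.tmul_smul, ← op_algebraMap_smul, op_smul_tmul, ← insert_smul,
        algebraMap_smul, TensorProduct.tmul_smul, tmul]

theorem insertThree_tmul (a : A) (x : H) (w : H ⊗[k] H) :
    insertThree a (x ⊗ₜ[k] w) = BalTensor.tmul A (tmul a x) (insert (1 ⊗ₜ[k] w)) := rfl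

/-- `Δ` as a left linear map. -/
def comulL : TensorCoring k H A →ₗ[A] BalTensor A (TensorCoring k H A) (TensorCoring k H A) where
  toFun := comulHom
  map_add' := map_add _
  map_smul' a x := by
    obtain ⟨x, rfl⟩ := exists_of x
    have h : ∀ x : A ⊗[k] H, (comul : H →ₗ[k] H ⊗[k] H).lTensor A (a • x) =
        a • (comul : H →ₗ[k] H ⊗[k] H).lTensor A x := by
      intro x
      induction x with
      | zero => simp
      | tmul b h => simp [TensorProduct.smul_tmul']
      | add x y hx hy => simp only [smul_add, map_add, hx, hy]
    rw [← map_smul, comulHom_of, h, insert_smul]; rfl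

/-- `Δ` as a right linear map. -/
def comulR :
    TensorCoring k H A →ₗ[Aᵐᵒᵖ] BalTensor A (TensorCoring k H A) (TensorCoring k H A) where
  toFun := comulHom
  map_add' := map_add _
  map_smul' b x := by
    obtain ⟨x, rfl⟩ := exists_of x
    rw [op_smul_of, comulHom_of, lTensor_comul_mul, insert_mul]; rfl

/-- `ε` as a left linear map. -/
def counitL : TensorCoring k H A →ₗ[A] A where
  toFun := counitHom
  map_add' := map_add _
  map_smul' a x := by
    obtain ⟨x, rfl⟩ := exists_of x
    rw [← map_smul, smul_eq_tmul_mul, counitHom_mul]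
    change counitHom (tmul a 1 : TensorCoring k H A) * _ = _
    rw [counitHom_tmul]
    simp

/-- `ε` as a right linear map. -/
def counitR : TensorCoring k H A →ₗ[Aᵐᵒᵖ] A where
  toFun := counitHom
  map_add' := map_add _
  map_smul' b x := by
    obtain ⟨x, rfl⟩ := exists_of x
    rw [op_smul_of, counitHom_mul, counitHom_coact]; rfl

/-- The `A`-coring `A ⊗ H`: `Δ(a ⊗ h) = (a ⊗ h₁) ⊗ (1 ⊗ h₂)` and `ε(a ⊗ h) = ε(h) a`. -/
instance : Coring A (TensorCoring k H A) where
  comul := comulL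
  comulR := comulR
  comulR_eq _ := rfl
  counit := counitL
  counitR := counitR
  counitR_eq _ := rfl
  coassoc c := by
    obtain ⟨x, rfl⟩ := exists_of c
    induction x with
    | zero => simp
    | tmul a h =>
      have h1 : ∀ w : H ⊗[k] H, BalTensor.map LinearMap.id comulL (insert (a ⊗ₜ[k] w)) =
          insertThree a ((comul : H →ₗ[k] H ⊗[k] H).lTensor H w) := by
        intro w
        induction w with
        | zero => simp
        | tmul x y => rfl
        | add x y hx hy => simp only [TensorProduct.tmul_add, map_add, hx, hy]
      have h2 : ∀ w : H ⊗[k] H,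
          BalTensor.assoc (BalTensor.map comulR LinearMap.id (insert (a ⊗ₜ[k] w))) =
          insertThree a
            (TensorProduct.assoc k H H H ((comul : H →ₗ[k] H ⊗[k] H).rTensor H w)) := by
        intro w
        induction w with
        | zero => simp
        | tmul x y =>
          have h3 : ∀ v : H ⊗[k] H,
              BalTensor.assoc (BalTensor.tmul A (insert (a ⊗ₜ[k] v)) (tmul 1 y)) =
              insertThree a (TensorProduct.assoc k H H H (v ⊗ₜ[k] y)) := by
            intro v
            induction v with
            | zero => simp [BalTensor.zero_tmul]
            | tmul x z => rfl
            | add x y hx hy =>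
              simp only [TensorProduct.tmul_add, TensorProduct.add_tmul, map_add,
                BalTensor.add_tmul, hx, hy]
          exact h3 (comul x)
        | add x y hx hy => simp only [TensorProduct.tmul_add, map_add, hx, hy]
      change BalTensor.assoc (BalTensor.map comulR LinearMap.id (insert (a ⊗ₜ[k] comul h))) =
        BalTensor.map LinearMap.id comulL (insert (a ⊗ₜ[k] comul h))
      rw [h1, h2, Coalgebra.coassoc_apply]
    | add x y hx hy => simp only [map_add, hx, hy]
  counit_left c := by
    obtain ⟨x, rfl⟩ := exists_of c
    induction x with
    | zero => simp
    | tmul a h =>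
      have h1 : ∀ w : H ⊗[k] H, BalTensor.contractLeft counitR (insert (a ⊗ₜ[k] w)) =
          (of (a ⊗ₜ[k] TensorProduct.lid k H ((counit : H →ₗ[k] k).rTensor H w)) :
            TensorCoring k H A) := by
        intro w
        induction w with
        | zero => simp
        | tmul x y =>
          rw [insert_tmul, contractLeft_tmul]
          change counitHom (tmul a x : TensorCoring k H A) • _ = _
          rw [counitHom_tmul, tmul, ← map_smul, TensorProduct.smul_tmul']
          simp [TensorProduct.smul_tmul]
        | add x y hx hy => simp only [TensorProduct.tmul_add, map_add, hx, hy]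
      change BalTensor.contractLeft counitR (insert (a ⊗ₜ[k] comul h)) = _
      rw [h1, Coalgebra.rTensor_counit_comul]
      simp
    | add x y hx hy => simp only [map_add, hx, hy]
  counit_right c := by
    obtain ⟨x, rfl⟩ := exists_of c
    induction x with
    | zero => simp
    | tmul a h =>
      have h1 : ∀ w : H ⊗[k] H, BalTensor.contractRight counitL (insert (a ⊗ₜ[k] w)) =
          (of (a ⊗ₜ[k] TensorProduct.rid k H ((counit : H →ₗ[k] k).lTensor H w)) :
            TensorCoring k H A) := by
        intro w
        induction w with
        | zero => simp
        | tmul x y =>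
          rw [insert_tmul, contractRight_tmul]
          change op (counitHom (tmul 1 y : TensorCoring k H A)) • _ = _
          rw [counitHom_tmul, ← Algebra.algebraMap_eq_smul_one, tmul, op_algebraMap_smul]
          simp [TensorProduct.tmul_smul]
        | add x y hx hy => simp only [TensorProduct.tmul_add, map_add, hx, hy]
      change BalTensor.contractRight counitL (insert (a ⊗ₜ[k] comul h)) = _
      rw [h1, Coalgebra.lTensor_counit_comul]
      simp
    | add x y hx hy => simp only [map_add, hx, hy]

end TensorCoring

/-! ### Smash products -/

section Twist

variable {k : Type*} [CommRing k] {K : Type*} [Ring K] [Algebra k K] {A : Type*} [Ring A]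
variable [Algebra k A]

/-- For linear `f : K → A` and `u ∈ K`, the linear map `A ⊗ K → A`, `a ⊗ y ↦ f(yu) a`. -/
def twist (f : K →ₗ[k] A) (u : K) : A ⊗[k] K →ₗ[k] A :=
  TensorProduct.lift ((LinearMap.mul k A).flip.compl₂ (f ∘ₗ LinearMap.mulRight k u))

theorem twist_tmul (f : K →ₗ[k] A) (u : K) (a : A) (y : K) :
    twist f u (a ⊗ₜ[k] y) = f (y * u) * a := rfl

/-- `twist f u`, linear in `u`. -/
def twistₗ (f : K →ₗ[k] A) : K →ₗ[k] A ⊗[k] K →ₗ[k] A where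
  toFun := twist f
  map_add' u v := by
    ext a y
    simp [twist_tmul, mul_add, add_mul]
  map_smul' r u := by
    ext a y
    simp [twist_tmul]

theorem twistₗ_tmul (f : K →ₗ[k] A) (u : K) (a : A) (y : K) :
    twistₗ f u (a ⊗ₜ[k] y) = f (y * u) * a := rfl

end Twist

/-- The big smash product `#(H, A)`: the `k`-linear maps `H → A`. -/
@[ext]
structure BigSmash (k H A : Type*) [CommRing k] [Ring H] [Algebra k H] [Ring A]
    [Algebra k A] where
  /-- The underlying linear map. -/
  toLin : H →ₗ[k] A

namespace BigSmash

section Additive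

variable {k H A : Type*} [CommRing k] [Ring H] [Algebra k H] [Ring A] [Algebra k A]

/-- The bijection between `#(H, A)` and the linear maps `H → A`. -/
def equiv : BigSmash k H A ≃ (H →ₗ[k] A) := ⟨toLin, mk, fun _ => rfl, fun _ => rfl⟩

instance : AddCommGroup (BigSmash k H A) := equiv.addCommGroup

instance : CoeFun (BigSmash k H A) (fun _ => H → A) := ⟨fun f => f.toLin⟩

theorem ext' {f g : BigSmash k H A} (h : ∀ x, f x = g x) : f = g :=
  BigSmash.ext (LinearMap.ext h)

theorem toLin_add (f g : BigSmash k H A) : (f + g).toLin = f.toLin + g.toLin := rfl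

theorem toLin_zero : (0 : BigSmash k H A).toLin = 0 := rfl

end Additive

variable [ComoduleAlgebra k H A]

/-- The linear map `H ⊗ H → A`, `x ⊗ y ↦ f(g(y)₁ x) g(y)₀`. -/
def mulAux (f g : H →ₗ[k] A) : H ⊗[k] H →ₗ[k] A :=
  TensorProduct.lift ((twistₗ f).compl₂ ((coact k H A).toLinearMap ∘ₗ g))

theorem mulAux_tmul (f g : H →ₗ[k] A) (x y : H) :
    mulAux f g (x ⊗ₜ[k] y) = twistₗ f x (coact k H A (g y)) := rfl

/-- `(f · g)(h) = f(g(h₂)₁ h₁) g(h₂)₀` -/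
instance : Mul (BigSmash k H A) where
  mul f g := ⟨mulAux f.toLin g.toLin ∘ₗ comul⟩

/-- The unit is `h ↦ ε(h) 1`. -/
instance : One (BigSmash k H A) where
  one := ⟨Algebra.linearMap k A ∘ₗ counit⟩

theorem mul_apply (f g : BigSmash k H A) (h : H) :
    (f * g) h = mulAux f.toLin g.toLin (comul h) := rfl

theorem one_apply (h : H) : (1 : BigSmash k H A) h = algebraMap k A (counit h) := rfl

theorem one_mul' (g : BigSmash k H A) : 1 * g = g := by
  refine ext' fun h => ?_
  have h1 : ∀ (x : H) (w : A ⊗[k] H), twistₗ (1 : BigSmash k H A).toLin x w =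
      counit (R := k) x • TensorProduct.rid k A ((counit : H →ₗ[k] k).lTensor A w) := by
    intro x w
    induction w with
    | zero => simp
    | tmul a y =>
      rw [twistₗ_tmul, one_apply, Bialgebra.counit_mul, ← Algebra.smul_def]
      simp [smul_smul, mul_comm]
    | add u v hu hv => simp only [map_add, hu, hv, smul_add]
  have h2 : ∀ w : H ⊗[k] H, mulAux (1 : BigSmash k H A).toLin g.toLin w =
      g (TensorProduct.lid k H ((counit : H →ₗ[k] k).rTensor H w)) := by
    intro w
    induction w with
    | zero => simp
    | tmul x y =>
      rw [mulAux_tmul, h1]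
      refine (congrArg _ (ComoduleAlgebra.counit_coact (g y))).trans ?_
      simp
    | add u v hu hv => simp only [map_add, hu, hv]
  rw [mul_apply, h2, Coalgebra.rTensor_counit_comul]
  simp

theorem mul_one' (f : BigSmash k H A) : f * 1 = f := by
  refine ext' fun h => ?_
  have h2 : ∀ w : H ⊗[k] H, mulAux f.toLin (1 : BigSmash k H A).toLin w =
      f (TensorProduct.rid k H ((counit : H →ₗ[k] k).lTensor H w)) := by
    intro w
    induction w with
    | zero => simp
    | tmul x y =>
      rw [mulAux_tmul, one_apply, AlgHom.commutes, Algebra.TensorProduct.algebraMap_apply,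
        twistₗ_tmul, one_mul, ← Algebra.commutes, ← Algebra.smul_def]
      simp
    | add u v hu hv => simp only [map_add, hu, hv]
  rw [mul_apply, h2, Coalgebra.lTensor_counit_comul]
  simp

theorem mul_assoc' (f g l : BigSmash k H A) : f * g * l = f * (g * l) := by
  refine ext' fun h => ?_
  have h1 : ∀ (u : H) (x : A ⊗[k] H), twistₗ (f * g).toLin u x =
      twistₗ (mulAux f.toLin g.toLin) (comul u)
        ((comul : H →ₗ[k] H ⊗[k] H).lTensor A x) := by
    intro u x
    induction x with
    | zero => simp
    | tmul a y =>
      rw [LinearMap.lTensor_tmul, twistₗ_tmul, twistₗ_tmul, mul_apply, Bialgebra.comul_mul]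
    | add x y hx hy => simp only [map_add, hx, hy]
  have h2 : ∀ (u v : H) (x : A ⊗[k] H),
      twistₗ f.toLin u (coact k H A (twistₗ g.toLin v x)) =
      twistₗ (mulAux f.toLin g.toLin) (u ⊗ₜ[k] v)
        (TensorProduct.assoc k A H H ((coact k H A).toLinearMap.rTensor H x)) := by
    intro u v x
    induction x with
    | zero => simp
    | tmul a z =>
      have h3 : ∀ (X w : A ⊗[k] H) (b : A) (y : H), twistₗ f.toLin u (X * (b ⊗ₜ[k] y)) =
          twistₗ f.toLin (y * u) X * b := by
        intro X w b y
        induction X with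
        | zero => simp
        | tmul c t => simp [twistₗ_tmul, mul_assoc]
        | add x y hx hy => simp only [map_add, add_mul, hx, hy]
      have h4 : ∀ w : A ⊗[k] H, twistₗ f.toLin u (coact k H A (g (z * v)) * w) =
          twistₗ (mulAux f.toLin g.toLin) (u ⊗ₜ[k] v)
            (TensorProduct.assoc k A H H (w ⊗ₜ[k] z)) := by
        intro w
        induction w with
        | zero => simp
        | tmul b y =>
          rw [h3 _ 0, TensorProduct.assoc_tmul, twistₗ_tmul,
            Algebra.TensorProduct.tmul_mul_tmul, mulAux_tmul]
        | add x y hx hy => simp only [map_add, mul_add, TensorProduct.add_tmul, hx, hy]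
      rw [twistₗ_tmul, map_mul, h4]
      rfl
    | add x y hx hy => simp only [map_add, hx, hy]
  set X : H →ₗ[k] A ⊗[k] (H ⊗[k] H) :=
    (comul : H →ₗ[k] H ⊗[k] H).lTensor A ∘ₗ (coact k H A).toLinearMap ∘ₗ l.toLin with hX
  set L : (H ⊗[k] H) ⊗[k] H →ₗ[k] A :=
    TensorProduct.lift ((twistₗ (mulAux f.toLin g.toLin)).compl₂ X) with hL
  have h5 : ∀ w : H ⊗[k] H, mulAux (f * g).toLin l.toLin w =
      L ((comul : H →ₗ[k] H ⊗[k] H).rTensor H w) := by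
    intro w
    induction w with
    | zero => simp
    | tmul x y => rw [mulAux_tmul, h1]; rfl
    | add x y hx hy => simp only [map_add, hx, hy]
  have h6 : ∀ w : H ⊗[k] H, mulAux f.toLin (g * l).toLin w =
      L ((TensorProduct.assoc k H H H).symm ((comul : H →ₗ[k] H ⊗[k] H).lTensor H w)) := by
    intro w
    induction w with
    | zero => simp
    | tmul x y =>
      have h7 : ∀ v : H ⊗[k] H, twistₗ f.toLin x (coact k H A (mulAux g.toLin l.toLin v)) =
          L ((TensorProduct.assoc k H H H).symm (x ⊗ₜ[k] v)) := by
        intro v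
        induction v with
        | zero => simp
        | tmul s t =>
          rw [mulAux_tmul, h2]
          refine congrArg (twistₗ (mulAux f.toLin g.toLin) (x ⊗ₜ[k] s)) ?_
          exact ComoduleAlgebra.coassoc (l t)
        | add x y hx hy => simp only [map_add, TensorProduct.tmul_add, hx, hy]
      exact h7 (comul y)
    | add x y hx hy => simp only [map_add, hx, hy]
  rw [mul_apply, mul_apply, h5, h6, Coalgebra.coassoc_symm_apply]

theorem mulAux_add_left (f f' g : H →ₗ[k] A) :
    mulAux (f + f') g = mulAux f g + mulAux f' g := by
  ext x y
  simp only [TensorProduct.AlgebraTensorModule.curry_apply, TensorProduct.curry_apply,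
    LinearMap.restrictScalars_self, LinearMap.add_apply, mulAux_tmul]
  generalize coact k H A (g y) = w
  induction w with
  | zero => simp
  | tmul a z => simp [twistₗ_tmul, add_mul]
  | add u v hu hv => simp only [map_add, hu, hv]; abel

theorem mulAux_add_right (f g g' : H →ₗ[k] A) :
    mulAux f (g + g') = mulAux f g + mulAux f g' := by
  ext x y
  simp [mulAux_tmul]

instance : Ring (BigSmash k H A) where
  left_distrib f g l := ext' fun h => by
    simp only [mul_apply, toLin_add, mulAux_add_right, LinearMap.add_apply]
  right_distrib f g l := ext' fun h => by
    simp only [mul_apply, toLin_add, mulAux_add_left, LinearMap.add_apply]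
  zero_mul g := ext' fun h => by
    have h0 := mulAux_add_left (0 : H →ₗ[k] A) 0 g.toLin
    rw [add_zero, left_eq_add] at h0
    simp [mul_apply, toLin_zero, h0]
  mul_zero f := ext' fun h => by
    have h0 := mulAux_add_right f.toLin (0 : H →ₗ[k] A) 0
    rw [add_zero, left_eq_add] at h0
    simp [mul_apply, toLin_zero, h0]
  one_mul := one_mul'
  mul_one := mul_one'
  mul_assoc := mul_assoc'
  zsmul := zsmulRec
  neg_add_cancel := neg_add_cancel
  sub_eq_add_neg := sub_eq_add_neg

end BigSmash

/-- The dual algebra `H* = Hom_k(H, k)` with the convolution product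
`(p q)(h) = p(h₁) q(h₂)` and the unit `ε`. -/
def DualAlg (k H : Type*) [CommRing k] [Ring H] [Bialgebra k H] : Type _ :=
  WithConv (H →ₗ[k] k)

namespace DualAlg

variable {k H : Type*} [CommRing k] [Ring H] [Bialgebra k H]

instance : Ring (DualAlg k H) := inferInstanceAs (Ring (WithConv (H →ₗ[k] k)))

instance : Algebra k (DualAlg k H) := inferInstanceAs (Algebra k (WithConv (H →ₗ[k] k)))

/-- A linear form on `H`, as an element of the dual algebra. -/
def of : (H →ₗ[k] k) ≃ₗ[k] DualAlg k H where
  toFun p := WithConv.toConv p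
  invFun p := WithConv.ofConv p
  map_add' _ _ := rfl
  map_smul' _ _ := rfl
  left_inv _ := rfl
  right_inv _ := rfl

instance : CoeFun (DualAlg k H) (fun _ => H → k) := ⟨fun p => of.symm p⟩

@[simp]
theorem of_apply (p : H →ₗ[k] k) (h : H) : (of p) h = p h := rfl

theorem ext' {p q : DualAlg k H} (h : ∀ x, p x = q x) : p = q :=
  of.symm.injective (LinearMap.ext h)

theorem mul_apply (p q : DualAlg k H) (h : H) :
    (p * q) h = LinearMap.mul' k k (TensorProduct.map (of.symm p) (of.symm q) (comul h)) := rfl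

theorem one_apply (h : H) : (1 : DualAlg k H) h = counit (R := k) h := rfl

/-- The right action of `H` on `H*`: `hit p y = p ↼ y`, where `(p ↼ y)(h) = p(yh)`. -/
def hit : DualAlg k H →ₗ[k] H →ₗ[k] DualAlg k H :=
  LinearMap.mk₂ k (fun p y => of (of.symm p ∘ₗ LinearMap.mulLeft k y))
    (fun p q y => rfl)
    (fun r p y => rfl)
    (fun p y z => ext' fun h => by simp [add_mul])
    (fun r p y => ext' fun h => by simp)

theorem hit_apply (p : DualAlg k H) (y h : H) : (hit p y) h = p (y * h) := rfl

theorem hit_one (p : DualAlg k H) : hit p 1 = p :=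
  ext' fun h => by rw [hit_apply, one_mul]

theorem hit_hit (p : DualAlg k H) (y z : H) : hit (hit p y) z = hit p (y * z) :=
  ext' fun h => by rw [hit_apply, hit_apply, hit_apply, mul_assoc]

theorem one_hit (y : H) : hit (1 : DualAlg k H) y = counit (R := k) y • 1 :=
  ext' fun h => by
    rw [hit_apply, map_smul, LinearMap.smul_apply, one_apply, one_apply, Bialgebra.counit_mul,
      smul_eq_mul]

theorem mul_hit (p q : DualAlg k H) (y : H) :
    hit (p * q) y = LinearMap.mul' k (DualAlg k H)
      (TensorProduct.map (hit p) (hit q) (comul y)) := by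
  refine ext' fun h => ?_
  rw [hit_apply, mul_apply, Bialgebra.comul_mul]
  generalize (comul y : H ⊗[k] H) = w
  induction w with
  | zero => simp
  | tmul u v =>
    rw [TensorProduct.map_tmul, LinearMap.mul'_apply, mul_apply]
    generalize (comul h : H ⊗[k] H) = w
    induction w with
    | zero => simp
    | tmul s t => simp [hit_apply]
    | add x y hx hy => simp only [map_add, mul_add, hx, hy]
  | add x y hx hy => simp only [map_add, add_mul, hx, hy, LinearMap.add_apply]

end DualAlg

open DualAlg (hit hit_one hit_hit one_hit mul_hit)

/-- The smash product `A # H*`, with underlying module `A ⊗ H*`. -/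
@[ext]
structure Smash (k H A : Type*) [CommRing k] [Ring H] [Bialgebra k H] [Ring A]
    [Algebra k A] where
  /-- The underlying element of `A ⊗ H*`. -/
  toTensor : A ⊗[k] DualAlg k H

namespace Smash

section Additive

/-- The bijection between `A # H*` and `A ⊗ H*`. -/
def equiv : Smash k H A ≃ A ⊗[k] DualAlg k H := ⟨toTensor, mk, fun _ => rfl, fun _ => rfl⟩

instance : AddCommGroup (Smash k H A) := equiv.addCommGroup

/-- The element `a # p` of the smash product. -/
def tmul (a : A) (p : DualAlg k H) : Smash k H A := ⟨a ⊗ₜ[k] p⟩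

theorem toTensor_add (x y : Smash k H A) : (x + y).toTensor = x.toTensor + y.toTensor := rfl

theorem toTensor_zero : (0 : Smash k H A).toTensor = 0 := rfl

end Additive

variable [ComoduleAlgebra k H A]

/-- The linear map `b ⊗ q ↦ (1 # p)(b # q) = b₀ ⊗ (p ↼ b₁) q`. -/
def lmulDual (p : DualAlg k H) : A ⊗[k] DualAlg k H →ₗ[k] A ⊗[k] DualAlg k H :=
  LinearMap.mul' k (A ⊗[k] DualAlg k H) ∘ₗ
    TensorProduct.map ((hit p).lTensor A ∘ₗ (coact k H A).toLinearMap)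
      (Algebra.TensorProduct.includeRight : DualAlg k H →ₐ[k] A ⊗[k] DualAlg k H).toLinearMap

theorem lmulDual_tmul (p q : DualAlg k H) (b : A) :
    lmulDual p (b ⊗ₜ[k] q) = (hit p).lTensor A (coact k H A b) * ((1 : A) ⊗ₜ[k] q) := rfl

/-- The bilinear map on `A ⊗ H*` given by `(a ⊗ p)(b ⊗ q) = a b₀ ⊗ (p ↼ b₁) q`. -/
def mulₗ : A ⊗[k] DualAlg k H →ₗ[k] A ⊗[k] DualAlg k H →ₗ[k] A ⊗[k] DualAlg k H :=
  TensorProduct.lift <| LinearMap.mk₂ k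
    (fun a p => LinearMap.mulLeft k (a ⊗ₜ[k] (1 : DualAlg k H)) ∘ₗ lmulDual p)
    (fun a a' p => by
      ext; simp [TensorProduct.add_tmul, add_mul])
    (fun r a p => by
      ext; simp [← TensorProduct.smul_tmul'])
    (fun a p p' => by
      ext b q; simp [lmulDual_tmul, LinearMap.lTensor_add, add_mul, mul_add])
    (fun r a p => by
      ext b q; simp [lmulDual_tmul, LinearMap.lTensor_smul])

theorem mulₗ_tmul (a : A) (p : DualAlg k H) (y : A ⊗[k] DualAlg k H) :
    mulₗ (a ⊗ₜ[k] p) y = (a ⊗ₜ[k] (1 : DualAlg k H)) * lmulDual p y := rfl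

/-- `(a # p)(b # q) = a b₀ # (p ↼ b₁) q` -/
instance : Mul (Smash k H A) where
  mul x y := ⟨mulₗ x.toTensor y.toTensor⟩

/-- The unit is `1 # ε`. -/
instance : One (Smash k H A) where
  one := ⟨1 ⊗ₜ[k] 1⟩

theorem toTensor_mul (x y : Smash k H A) : (x * y).toTensor = mulₗ x.toTensor y.toTensor := rfl

theorem toTensor_one : (1 : Smash k H A).toTensor = 1 ⊗ₜ[k] 1 := rfl

theorem one_mul' (x : Smash k H A) : 1 * x = x := by
  refine Smash.ext ?_
  rw [toTensor_mul, toTensor_one, mulₗ_tmul, ← Algebra.TensorProduct.one_def, one_mul]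
  generalize x.toTensor = y
  induction y with
  | zero => simp
  | tmul b q =>
    have h : ∀ w : A ⊗[k] H, (hit (1 : DualAlg k H)).lTensor A w =
        (TensorProduct.rid k A ((counit : H →ₗ[k] k).lTensor A w)) ⊗ₜ[k] 1 := by
      intro w
      induction w with
      | zero => simp
      | tmul a h => simp [one_hit, TensorProduct.smul_tmul]
      | add x y hx hy => simp only [map_add, TensorProduct.add_tmul, hx, hy]
    have hb : TensorProduct.rid k A ((counit : H →ₗ[k] k).lTensor A (coact k H A b)) = b :=
      ComoduleAlgebra.counit_coact b
    rw [lmulDual_tmul, h, hb]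
    simp
  | add x y hx hy => rw [map_add, hx, hy]

theorem mul_one' (x : Smash k H A) : x * 1 = x := by
  refine Smash.ext ?_
  rw [toTensor_mul, toTensor_one]
  generalize x.toTensor = y
  induction y with
  | zero => simp
  | tmul b q =>
    rw [mulₗ_tmul, lmulDual_tmul, map_one, ← Algebra.TensorProduct.one_def, mul_one,
      Algebra.TensorProduct.one_def, LinearMap.lTensor_tmul, hit_one]
    simp
  | add x y hx hy => rw [map_add, LinearMap.add_apply, hx, hy]

theorem mulₗ_mul_right (x y : A ⊗[k] DualAlg k H) (r : DualAlg k H) :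
    mulₗ x (y * ((1 : A) ⊗ₜ[k] r)) = mulₗ x y * ((1 : A) ⊗ₜ[k] r) := by
  induction x with
  | zero => simp
  | tmul a p =>
    induction y with
    | zero => simp
    | tmul b q =>
      rw [Algebra.TensorProduct.tmul_mul_tmul, mulₗ_tmul, mulₗ_tmul, lmulDual_tmul,
        lmulDual_tmul]
      simp [mul_assoc]
    | add x y hx hy => simp only [add_mul, map_add, hx, hy]
  | add x y hx hy => simp only [add_mul, map_add, LinearMap.add_apply, hx, hy]

theorem mulₗ_mul_left (a : A) (x y : A ⊗[k] DualAlg k H) :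
    mulₗ ((a ⊗ₜ[k] (1 : DualAlg k H)) * x) y = (a ⊗ₜ[k] (1 : DualAlg k H)) * mulₗ x y := by
  induction x with
  | zero => simp
  | tmul b p =>
    rw [Algebra.TensorProduct.tmul_mul_tmul, mulₗ_tmul, mulₗ_tmul, ← mul_assoc]
    simp
  | add x y hx hy => simp only [mul_add, map_add, LinearMap.add_apply, hx, hy]

/-- Associativity for the factors `1 # p`, `b # q` and `c # 1`. -/
theorem mulₗ_assoc_aux (p q : DualAlg k H) (b c : A) :
    mulₗ (lmulDual p (b ⊗ₜ[k] q)) (c ⊗ₜ[k] 1) =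
      lmulDual p ((b ⊗ₜ[k] (1 : DualAlg k H)) * (hit q).lTensor A (coact k H A c)) := by
  have hL : ∀ X : A ⊗[k] H,
      mulₗ ((hit p).lTensor A X * ((1 : A) ⊗ₜ[k] q)) (c ⊗ₜ[k] 1) =
      (LinearMap.lTensor A (LinearMap.mul' k (DualAlg k H) ∘ₗ
          TensorProduct.map (hit p) (hit q)))
        (TensorProduct.assoc k A H H (X ⊗ₜ[k] 1) *
          (comul : H →ₗ[k] H ⊗[k] H).lTensor A (coact k H A c)) := by
    intro X
    induction X with
    | zero => simp
    | tmul a y =>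
      rw [LinearMap.lTensor_tmul, Algebra.TensorProduct.tmul_mul_tmul, mulₗ_tmul,
        lmulDual_tmul, mul_one, ← Algebra.TensorProduct.one_def, mul_one]
      generalize coact k H A c = w
      induction w with
      | zero => simp
      | tmul c z =>
        rw [LinearMap.lTensor_tmul, mul_hit, LinearMap.lTensor_tmul, TensorProduct.assoc_tmul]
        generalize (comul z : H ⊗[k] H) = v
        induction v with
        | zero => simp
        | tmul s t => simp [hit_hit]
        | add x y hx hy => simp only [map_add, TensorProduct.tmul_add, mul_add, hx, hy]
      | add x y hx hy => simp only [map_add, mul_add, hx, hy]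
    | add x y hx hy =>
      simp only [map_add, add_mul, TensorProduct.add_tmul, LinearMap.add_apply, hx, hy]
  have hR : ∀ w : A ⊗[k] H,
      lmulDual p ((b ⊗ₜ[k] (1 : DualAlg k H)) * (hit q).lTensor A w) =
      (LinearMap.lTensor A (LinearMap.mul' k (DualAlg k H) ∘ₗ
          TensorProduct.map (hit p) (hit q)))
        (TensorProduct.assoc k A H H (coact k H A b ⊗ₜ[k] 1) *
          TensorProduct.assoc k A H H ((coact k H A).toLinearMap.rTensor H w)) := by
    intro w
    induction w with
    | zero => simp
    | tmul c z =>
      rw [LinearMap.lTensor_tmul, Algebra.TensorProduct.tmul_mul_tmul, lmulDual_tmul, map_mul,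
        one_mul, LinearMap.rTensor_tmul]
      change _ = (LinearMap.lTensor A _) (_ * TensorProduct.assoc k A H H
        (coact k H A c ⊗ₜ[k] z))
      generalize coact k H A c = v
      generalize coact k H A b = u
      induction u with
      | zero => simp
      | tmul a y =>
        induction v with
        | zero => simp
        | tmul s t => simp
        | add x y hx hy =>
          simp only [map_add, TensorProduct.add_tmul, mul_add, add_mul, hx, hy]
      | add x y hx hy =>
        simp only [map_add, TensorProduct.add_tmul, add_mul, hx, hy]
    | add x y hx hy => simp only [map_add, mul_add, hx, hy]
  have hc : TensorProduct.assoc k A H H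
      ((coact k H A).toLinearMap.rTensor H (coact k H A c)) =
      (comul : H →ₗ[k] H ⊗[k] H).lTensor A (coact k H A c) := ComoduleAlgebra.coassoc c
  rw [lmulDual_tmul, hL, hR, hc]

theorem mul_assoc' (x y z : Smash k H A) : x * y * z = x * (y * z) := by
  refine Smash.ext ?_
  simp only [toTensor_mul]
  generalize x.toTensor = x
  generalize y.toTensor = y
  generalize z.toTensor = z
  induction x with
  | zero => simp
  | tmul a p =>
    induction y with
    | zero => simp
    | tmul b q =>
      induction z with
      | zero => simp
      | tmul c r =>
        have hc : c ⊗ₜ[k] r = (c ⊗ₜ[k] (1 : DualAlg k H)) * ((1 : A) ⊗ₜ[k] r) := by simp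
        rw [hc, mulₗ_mul_right, mulₗ_mul_right, mulₗ_mul_right, mulₗ_tmul a p (b ⊗ₜ[k] q),
          mulₗ_mul_left, mulₗ_assoc_aux, mulₗ_tmul, mulₗ_tmul b q, lmulDual_tmul,
          ← Algebra.TensorProduct.one_def, mul_one]
      | add x y hx hy => simp only [map_add, hx, hy]
    | add x y hx hy => simp only [map_add, LinearMap.add_apply, hx, hy]
  | add x y hx hy => simp only [map_add, LinearMap.add_apply, hx, hy]

instance : Ring (Smash k H A) where
  left_distrib x y z := Smash.ext <| by simp only [toTensor_mul, toTensor_add, map_add]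
  right_distrib x y z := Smash.ext <| by
    simp only [toTensor_mul, toTensor_add, map_add, LinearMap.add_apply]
  zero_mul x := Smash.ext <| by simp [toTensor_mul, toTensor_zero]
  mul_zero x := Smash.ext <| by simp [toTensor_mul, toTensor_zero]
  one_mul := one_mul'
  mul_one := mul_one'
  mul_assoc := mul_assoc'
  zsmul := zsmulRec
  neg_add_cancel := neg_add_cancel
  sub_eq_add_neg := sub_eq_add_neg

end Smash

end HopfCoring

end

open HopfCoring

/-! **Bijectivity of the antipode.** Fix dual bases `e i`, `p i` of `H`. A left integral is a form θ
with x₁ θ(x₂) = θ(x) 1. For such θ, anti-comultiplicativity of S (`comul_antipode`) gives x₁ θ(x₂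
S(h)) = θ(x S(h₁)) h₂ (`hitMul_antipode`), so the right-hand side depends on S(h) alone. Put x = y
S²(eᵢ), apply h ↦ pᵢ(h₁) h₂ and sum over i: the result is θ(y S²(h₂) S(h₁)) h₃ = θ(y S(h₁ S(h₂))) h₃
= θ(y) h. Thus S has a left inverse once there are left integrals θⱼ and elements yⱼ with ∑ⱼ θⱼ(yⱼ)
= 1. The trace-like forms x ↦ ∑ᵢ (pᵢ f)(x S²(eᵢ)) are left integrals (`hitLeft_traceForm`), and f =
pⱼ, yⱼ = S(eⱼ) satisfy the normalisation (`sum_traceForm_antipode`). Only this unit-ideal property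
is needed, not freeness of the module of integrals. A left inverse is a surjective endomorphism of a
finite module, hence bijective, and so S is bijective.

**The isomorphisms.** Finite projectivity identifies A ⊗ H* with Hom(H, A), and this carries the
product of A # H* to that of #(H, A) (`tensorHom_mulₗ`); this is the inverse of e. The map γ and its
inverse are checked directly: right linearity of a ⊗ h ↦ ζ(a₁ S(h)) a₀ rests on b₁ S(b₂) = ε(b), and
the inverse relation on S⁻¹(a₂) a₁ = ε(a).

A left linear form on A ⊗ H is determined by its values on 1 ⊗ h, so *(A ⊗ H) is also Hom(H, A) as a
group. The map in (3) is then the identification A ⊗ H* = Hom(H, A) preceded by the twist a ⊗ p ↦ a₀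
⊗ p(S⁻¹(- a₁)), whose inverse is a ⊗ p ↦ a₀ ⊗ p(S(a₁ -)) (`coactLift_invHit_bijective`).
Multiplicativity is tested on left factors a # 1 and 1 # p, whose products give all a # p; the
second case is the identity `invHit_hit_mul_comul`. Finally α is defined as the composite that makes
(3) this very map. -/

namespace HopfCoring

open Coalgebra (comul counit)
open HopfAlgebra (antipode)
open WithConv (toConv)

/-! ### The antipode of a finitely generated projective Hopf algebra -/

section Antipode

variable {k H : Type*} [CommRing k] [Ring H] [HopfAlgebra k H]

/-- The antipode reverses the comultiplication. -/
theorem comul_antipode (x : H) :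
    comul (antipode k x) =
      TensorProduct.map (antipode k) (antipode k) (TensorProduct.comm k H H (comul x)) := by
  let i₁ : H →ₐ[k] H ⊗[k] H := Algebra.TensorProduct.includeLeft
  let i₂ : H →ₐ[k] H ⊗[k] H := Algebra.TensorProduct.includeRight
  let G : H →ₗ[k] H ⊗[k] H :=
    TensorProduct.map (antipode k) (antipode k) ∘ₗ (TensorProduct.comm k H H).toLinearMap ∘ₗ comul
  have inv : ∀ i : H →ₐ[k] H ⊗[k] H,
      toConv (i.toLinearMap ∘ₗ antipode k) * toConv i.toLinearMap = 1 := by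
    intro i
    have h := LinearMap.algHom_comp_convMul_distrib i (toConv (antipode k (A := H)))
      (toConv LinearMap.id)
    rw [LinearMap.antipode_mul_id] at h
    refine WithConv.ext (Eq.trans h.symm ?_)
    ext y
    simp
  have hD : toConv (comul (R := k) (A := H)) = toConv i₁.toLinearMap * toConv i₂.toLinearMap := by
    refine WithConv.ext (LinearMap.ext fun y => ?_)
    change _ = LinearMap.mul' k (H ⊗[k] H)
      (TensorProduct.map i₁.toLinearMap i₂.toLinearMap (comul y))
    change comul y = _
    generalize (comul y : H ⊗[k] H) = w
    induction w with
    | zero => simp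
    | tmul a b => simp [i₁, i₂]
    | add a b ha hb => rw [map_add, map_add, ← ha, ← hb]
  have hG : toConv G =
      toConv (i₂.toLinearMap ∘ₗ antipode k) * toConv (i₁.toLinearMap ∘ₗ antipode k) := by
    refine WithConv.ext (LinearMap.ext fun y => ?_)
    change TensorProduct.map _ _ (TensorProduct.comm k H H (comul y)) =
      LinearMap.mul' k (H ⊗[k] H) (TensorProduct.map _ _ (comul y))
    generalize (comul y : H ⊗[k] H) = w
    induction w with
    | zero => simp
    | tmul a b => simp [i₁, i₂]
    | add a b ha hb => simp only [map_add, ha, hb]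
  -- The two inclusions satisfy Δ = i₁ * i₂, and G = (i₂ S) * (i₁ S), so the product telescopes.
  -- Since Δ ∘ S is a right convolution inverse of Δ, it equals the left inverse G.
  have hGD : toConv G * toConv (comul (R := k) (A := H)) = 1 := by
    rw [hG, hD, mul_assoc, ← mul_assoc (toConv (i₁.toLinearMap ∘ₗ antipode k)), inv, one_mul, inv]
  have h := left_inv_eq_right_inv hGD LinearMap.comul_right_inv
  exact (LinearMap.congr_fun (congrArg WithConv.ofConv h) x).symm

/-- A linear form on `H`, viewed as a linear map `H → H` with scalar values. -/
noncomputable def scalarConv : WithConv (H →ₗ[k] k) →ₗ[k] WithConv (H →ₗ[k] H) where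
  toFun f := toConv (Algebra.linearMap k H ∘ₗ f.ofConv)
  map_add' _ _ := WithConv.ext <| LinearMap.ext fun _ => map_add (algebraMap k H) _ _
  map_smul' r _ := WithConv.ext <| LinearMap.ext fun _ =>
    (map_mul (algebraMap k H) r _).trans (Algebra.smul_def _ _).symm

theorem scalarConv_apply (f : WithConv (H →ₗ[k] k)) (x : H) :
    scalarConv f x = algebraMap k H (f x) := rfl

theorem scalarConv_mul (f g : WithConv (H →ₗ[k] k)) :
    scalarConv (f * g) = scalarConv f * scalarConv g :=
  WithConv.ext (LinearMap.algHom_comp_convMul_distrib (Algebra.ofId k H) f g)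

theorem scalarConv_one : scalarConv (1 : WithConv (H →ₗ[k] k)) = 1 := rfl

/-- `x₁ f(x₂)` -/
noncomputable def hitLeft (f : WithConv (H →ₗ[k] k)) : WithConv (H →ₗ[k] H) :=
  toConv LinearMap.id * scalarConv f

/-- `f(x₁) x₂` -/
noncomputable def hitRight (f : WithConv (H →ₗ[k] k)) : WithConv (H →ₗ[k] H) :=
  scalarConv f * toConv LinearMap.id

/-- By linearity the scalar f(x₁) passes through `hitRight g`, leaving f(x₁) g(x₂) x₃. Recovering h
from f(h₁) h₂ is thereby reduced to writing ε as a sum of convolution products. -/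
theorem hitRight_hitRight (f g : WithConv (H →ₗ[k] k)) (x : H) :
    hitRight g (hitRight f x) = hitRight (f * g) x := by
  have h1 : ∀ w : H ⊗[k] H, hitRight g (LinearMap.mul' k H
      (TensorProduct.map (scalarConv f).ofConv LinearMap.id w)) =
      LinearMap.mul' k H (TensorProduct.map (scalarConv f).ofConv (hitRight g).ofConv w) := by
    intro w
    induction w with
    | zero => exact map_zero (hitRight g).ofConv
    | tmul a b =>
      change (hitRight g).ofConv (algebraMap k H _ * b) =
        algebraMap k H _ * (hitRight g).ofConv b
      rw [← Algebra.smul_def, map_smul, Algebra.smul_def]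
    | add a b ha hb =>
      simp only [map_add, ← ha, ← hb]
  calc (hitRight g).ofConv ((hitRight f).ofConv x)
      _ = (scalarConv f * hitRight g) x := h1 (comul x)
      _ = _ := by rw [hitRight, ← mul_assoc, ← scalarConv_mul, hitRight]

/-- `h ↦ x₁ f(x₂ h)` -/
noncomputable def hitMul (f : WithConv (H →ₗ[k] k)) (x : H) : H →ₗ[k] H where
  toFun h := LinearMap.mul' k H (TensorProduct.map LinearMap.id
    ((scalarConv f).ofConv ∘ₗ LinearMap.mulRight k h) (comul x))
  map_add' h h' := by
    rw [← map_add, ← LinearMap.add_apply, ← TensorProduct.map_add_right, ← LinearMap.comp_add]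
    congr 4
    ext; simp [mul_add]
  map_smul' r h := by
    rw [RingHom.id_apply, ← map_smul, ← LinearMap.smul_apply, ← TensorProduct.map_smul_right,
      ← LinearMap.comp_smul]
    congr 4
    ext; simp

/-- `f(x₂ S(h)) x₁ = f(x₂ S(h₁)) x₁ S(h₂) h₃` -/
theorem hitMul_antipode (f : WithConv (H →ₗ[k] k)) (x : H) :
    toConv (hitMul f x ∘ₗ antipode k) =
      toConv ((hitLeft f).ofConv ∘ₗ LinearMap.mulLeft k x ∘ₗ antipode k) *
        toConv LinearMap.id := by
  -- Expanding Δ(x S(h)) = x₁ S(h₂) ⊗ x₂ S(h₁) isolates a right convolution factor S, which is then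
  -- cancelled by S * id = 1.
  have h : toConv ((hitLeft f).ofConv ∘ₗ LinearMap.mulLeft k x ∘ₗ antipode k) =
      toConv (hitMul f x ∘ₗ antipode k) * toConv (antipode k) := by
    refine WithConv.ext (LinearMap.ext fun h => ?_)
    change LinearMap.mul' k H (TensorProduct.map LinearMap.id (scalarConv f).ofConv
      (comul (x * antipode k h))) = LinearMap.mul' k H (TensorProduct.map _ _ (comul h))
    rw [Bialgebra.comul_mul, comul_antipode]
    generalize (comul h : H ⊗[k] H) = w
    induction w with
    | zero => simp
    | add a b ha hb => simp only [map_add, mul_add, ha, hb]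
    | tmul a b =>
      simp only [TensorProduct.comm_tmul, TensorProduct.map_tmul, hitMul, LinearMap.coe_comp,
        Function.comp_apply, LinearMap.coe_mk, AddHom.coe_mk, LinearMap.mul'_apply]
      generalize (comul x : H ⊗[k] H) = v
      induction v with
      | zero => simp
      | add a b ha hb => simp only [map_add, add_mul, ha, hb]
      | tmul c d =>
        simp only [Algebra.TensorProduct.tmul_mul_tmul, TensorProduct.map_tmul,
          LinearMap.mul'_apply, LinearMap.comp_apply, LinearMap.id_apply,
          LinearMap.mulRight_apply]
        change c * antipode k b * algebraMap k H _ = c * algebraMap k H _ * antipode k b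
        rw [mul_assoc, mul_assoc, Algebra.commutes]
  rw [h, mul_assoc, LinearMap.antipode_mul_id, mul_one]

end Antipode

/-! ### Left integrals from dual bases, and bijectivity of the antipode -/

section Integral

variable {k H : Type*} [CommRing k] [Ring H] [HopfAlgebra k H]
variable {n : ℕ} {e : Fin n → H} {p : Fin n → WithConv (H →ₗ[k] k)}

theorem sum_apply_smul_dual (hp : ∀ h, ∑ i, p i h • e i = h) (q : WithConv (H →ₗ[k] k)) :
    ∑ i, q (e i) • p i = q := by
  refine WithConv.ext (LinearMap.ext fun x => ?_)
  conv_rhs => rw [← hp x]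
  simp [mul_comm]

theorem sum_map_smul_tmul (hp : ∀ h, ∑ i, p i h • e i = h) (z : H ⊗[k] H) :
    ∑ i, ∑ j, LinearMap.mul' k k (TensorProduct.map (p i).ofConv (p j).ofConv z) •
      (e i ⊗ₜ[k] e j) = z := by
  induction z with
  | zero => simp
  | tmul a b =>
    conv_rhs => rw [← hp a, ← hp b, TensorProduct.sum_tmul]
    simp only [TensorProduct.tmul_sum, TensorProduct.map_tmul, LinearMap.mul'_apply,
      TensorProduct.smul_tmul_smul]
  | add a b ha hb =>
    simp only [map_add, add_smul, Finset.sum_add_distrib, ha, hb]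

/-- The comultiplication of the canonical element of `H* ⊗ H`. -/
theorem sum_dual_tmul_comul (hp : ∀ h, ∑ i, p i h • e i = h) :
    ∑ i, p i ⊗ₜ[k] (comul (e i) : H ⊗[k] H) =
      ∑ i, ∑ j, (p i * p j) ⊗ₜ[k] (e i ⊗ₜ[k] e j) := by
  -- The coefficient of eᵢ ⊗ eⱼ in Δ(eₗ) is (pᵢ pⱼ)(eₗ). Moving it across the tensor sign and
  -- summing over l reassembles pᵢ pⱼ.
  calc _ = ∑ l, ∑ i, ∑ j, ((p i * p j) (e l) • p l) ⊗ₜ[k] (e i ⊗ₜ[k] e j) := by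
        refine Finset.sum_congr rfl fun l _ => ?_
        conv_lhs => rw [← sum_map_smul_tmul hp (comul (e l))]
        simp only [TensorProduct.tmul_sum, TensorProduct.smul_tmul, LinearMap.convMul_apply]
    _ = _ := by
        rw [Finset.sum_comm]
        refine Finset.sum_congr rfl fun i _ => ?_
        rw [Finset.sum_comm]
        refine Finset.sum_congr rfl fun j _ => ?_
        rw [← TensorProduct.sum_tmul, sum_apply_smul_dual hp]

/-- `∑ᵢ z₁ pᵢ(z₂) r(z₃) S(eᵢ) = r(z)` -/
theorem sum_hitLeft_mul_antipode (hp : ∀ h, ∑ i, p i h • e i = h) (r : WithConv (H →ₗ[k] k))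
    (z : H) : ∑ i, hitLeft (p i * r) z * antipode k (e i) = algebraMap k H (r z) := by
  let T : Fin n → WithConv (H →ₗ[k] H) := fun i =>
    toConv (LinearMap.mulRight k (antipode k (e i)) ∘ₗ (scalarConv (p i)).ofConv)
  have h1 : ∀ i, hitLeft (p i * r) z * antipode k (e i) =
      (toConv LinearMap.id * (T i * scalarConv r)).ofConv z := by
    intro i
    have h2 : ∀ y, scalarConv (p i * r) y * antipode k (e i) = (T i * scalarConv r) y := by
      intro y
      rw [scalarConv_mul]
      change LinearMap.mul' k H (TensorProduct.map _ _ (comul y)) * _ =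
        LinearMap.mul' k H (TensorProduct.map _ _ (comul y))
      generalize (comul y : H ⊗[k] H) = w
      induction w with
      | zero => simp
      | add a b ha hb => simp only [map_add, add_mul, ha, hb]
      | tmul a b =>
        change _ * algebraMap k H _ * _ = _ * _ * algebraMap k H _
        rw [mul_assoc, Algebra.commutes, mul_assoc]
    change LinearMap.mul' k H (TensorProduct.map _ _ (comul z)) * _ =
      LinearMap.mul' k H (TensorProduct.map _ _ (comul z))
    generalize (comul z : H ⊗[k] H) = w
    induction w with
    | zero => simp
    | add a b ha hb => simp only [map_add, add_mul, ha, hb]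
    | tmul a b =>
      rw [TensorProduct.map_tmul, TensorProduct.map_tmul, LinearMap.mul'_apply,
        LinearMap.mul'_apply, ← h2, mul_assoc]
  -- Since ∑ pᵢ(y) S(eᵢ) = S(y), the whole sum becomes the convolution id * S * r, where id * S = 1.
  have h3 : ∑ i, T i = toConv (antipode k) := by
    refine WithConv.ext (LinearMap.ext fun y => ?_)
    conv_rhs => rw [← hp y]
    simp [T, scalarConv_apply, ← Algebra.smul_def]
  calc _ = (∑ i, toConv LinearMap.id * (T i * scalarConv r)).ofConv z := by
        simp only [h1, WithConv.ofConv_sum, LinearMap.sum_apply]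
    _ = scalarConv r z := by
        rw [← Finset.mul_sum, ← Finset.sum_mul, h3, ← mul_assoc, LinearMap.id_mul_antipode,
          one_mul]

/-- The linear form `x ↦ ∑ᵢ (pᵢ f)(x S²(eᵢ))`. -/
noncomputable def traceForm (e : Fin n → H) (p : Fin n → WithConv (H →ₗ[k] k))
    (f : WithConv (H →ₗ[k] k)) : WithConv (H →ₗ[k] k) :=
  ∑ i, toConv ((p i * f).ofConv ∘ₗ LinearMap.mulRight k (antipode k (antipode k (e i))))

theorem traceForm_apply (f : WithConv (H →ₗ[k] k)) (x : H) :
    traceForm e p f x = ∑ i, (p i * f) (x * antipode k (antipode k (e i))) := by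
  simp [traceForm, -LinearMap.convMul_apply]

/-- `traceForm e p f` is a left integral on `H`. -/
theorem hitLeft_traceForm (hp : ∀ h, ∑ i, p i h • e i = h) (f : WithConv (H →ₗ[k] k)) :
    hitLeft (traceForm e p f) = scalarConv (traceForm e p f) := by
  refine WithConv.ext (LinearMap.ext fun x => ?_)
  -- `q ⊗ (a ⊗ b) ↦ z₁ (q f)(z₂) S(a)` for `z = x S²(b)`
  let U : WithConv (H →ₗ[k] k) →ₗ[k] H →ₗ[k] H := LinearMap.mk₂ k
    (fun q b => hitLeft (q * f) (x * antipode k (antipode k b)))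
    (fun q q' b => by simp only [hitLeft, add_mul, map_add, mul_add]; rfl)
    (fun c q b => by
      simp only [hitLeft, smul_mul_assoc, map_smul, mul_smul_comm]; rfl)
    (fun q b b' => by simp only [map_add, mul_add])
    (fun c q b => by simp only [map_smul, mul_smul_comm])
  let C : WithConv (H →ₗ[k] k) →ₗ[k] H ⊗[k] H →ₗ[k] H := LinearMap.mk₂ k
    (fun q w => LinearMap.mul' k H (TensorProduct.map (U q) (antipode k)
      (TensorProduct.comm k H H w)))
    (fun q q' w => by rw [map_add, TensorProduct.map_add_left, LinearMap.add_apply, map_add])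
    (fun c q w => by rw [map_smul, TensorProduct.map_smul_left, LinearMap.smul_apply, map_smul])
    (fun q w w' => by simp only [map_add])
    (fun c q w => by simp only [map_smul])
  -- `hitMul_antipode` is used at S(eᵢ). As Δ reverses under S, the first factor receives S²(eᵢ₂)
  -- and the second is S(eᵢ₁); this accounts for the flip in `C`.
  have h1 : ∀ i, hitMul (p i * f) x (antipode k (antipode k (e i))) = C (p i) (comul (e i)) := by
    intro i
    have h := congrArg (fun F => F.ofConv (antipode k (e i))) (hitMul_antipode (p i * f) x)
    refine h.trans ?_
    change LinearMap.mul' k H (TensorProduct.map _ _ (comul (antipode k (e i)))) =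
      LinearMap.mul' k H (TensorProduct.map (U (p i)) (antipode k)
        (TensorProduct.comm k H H (comul (e i))))
    rw [comul_antipode]
    generalize TensorProduct.comm k H H (comul (e i)) = w
    induction w with
    | zero => simp
    | add a b ha hb => simp only [map_add, ha, hb]
    | tmul a b => rfl
  -- Splitting Δ(eᵢ) in this way introduces a second index j and turns pᵢ into pᵢ pⱼ. The sum over i
  -- then collapses by `sum_hitLeft_mul_antipode` with r = pⱼ f and z = x S²(eⱼ).
  have h2 := congrArg (TensorProduct.lift C) (sum_dual_tmul_comul hp)
  simp only [map_sum, TensorProduct.lift.tmul] at h2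
  calc (hitLeft (traceForm e p f)).ofConv x
      = ∑ i, hitMul (p i * f) x (antipode k (antipode k (e i))) := by
        simp only [hitLeft, traceForm, map_sum, Finset.mul_sum, WithConv.ofConv_sum,
          LinearMap.sum_apply]
        rfl
    _ = ∑ j, ∑ i, hitLeft (p i * (p j * f)) (x * antipode k (antipode k (e j))) *
          antipode k (e i) := by
        simp only [h1, h2]
        rw [Finset.sum_comm]
        refine Finset.sum_congr rfl fun j _ => Finset.sum_congr rfl fun i _ => ?_
        rw [← mul_assoc (p i)]
        rfl
    _ = _ := by
        simp only [sum_hitLeft_mul_antipode hp]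
        rw [← map_sum, ← traceForm_apply]
        rfl

/-- The forms `traceForm e p pⱼ` generate the unit ideal of `k`. -/
theorem sum_traceForm_antipode (hp : ∀ h, ∑ i, p i h • e i = h) :
    ∑ j, traceForm e p (p j) (antipode k (e j)) = 1 := by
  -- The form q ⊗ a ⊗ b ↦ q(S(S(a) b)). The sum to compute is ∑ (pᵢ pⱼ)(S(eⱼ) S²(eᵢ)) = ∑ (pᵢ
  -- pⱼ)(S(S(eᵢ) eⱼ)), so comultiplying the canonical element backwards produces S(eᵢ₁) eᵢ₂ = ε(eᵢ).
  let C : WithConv (H →ₗ[k] k) →ₗ[k] H ⊗[k] H →ₗ[k] k := LinearMap.mk₂ k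
    (fun q w => q (antipode k (LinearMap.mul' k H ((antipode k).rTensor H w))))
    (fun q q' w => rfl)
    (fun c q w => rfl)
    (fun q w w' => by simp only [map_add])
    (fun c q w => by simp only [map_smul])
  have h2 := congrArg (TensorProduct.lift C) (sum_dual_tmul_comul hp)
  simp only [map_sum, TensorProduct.lift.tmul] at h2
  calc _ = ∑ i, ∑ j, C (p i * p j) (e i ⊗ₜ[k] e j) := by
        simp only [traceForm_apply]
        rw [Finset.sum_comm]
        refine Finset.sum_congr rfl fun j _ => Finset.sum_congr rfl fun i _ => ?_
        change _ = (p j * p i) (antipode k (antipode k (e j) * e i))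
        rw [HopfAlgebra.antipode_mul_antidistrib]
    _ = ∑ i, counit (R := k) (e i) • p i 1 := by
        rw [← h2]
        refine Finset.sum_congr rfl fun i _ => ?_
        change (p i).ofConv (antipode k (LinearMap.mul' k H ((antipode k).rTensor H _))) = _
        rw [HopfAlgebra.mul_antipode_rTensor_comul_apply, Algebra.algebraMap_eq_smul_one, map_smul,
          HopfAlgebra.antipode_one, map_smul]
    _ = counit (R := k) (∑ i, p i 1 • e i) := by simp [mul_comm]
    _ = 1 := by rw [hp, Bialgebra.counit_one]

/-- `∑ᵢ f(y S²(eᵢ) S(h₁)) pᵢ(h₂) = f(y) ε(h)` -/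
theorem sum_mulLeft_antipode_mul (hp : ∀ h, ∑ i, p i h • e i = h) (f : WithConv (H →ₗ[k] k))
    (y : H) :
    ∑ i, toConv (f.ofConv ∘ₗ
      LinearMap.mulLeft k (y * antipode k (antipode k (e i))) ∘ₗ antipode k) * p i =
      f y • (1 : WithConv (H →ₗ[k] k)) := by
  refine WithConv.ext (LinearMap.ext fun h => ?_)
  -- For w = a ⊗ b the sum over i replaces eᵢ by b, and S²(b) S(a) = S(a S(b)). For w = Δ(h) this is
  -- ε(h).
  have h1 : ∀ w : H ⊗[k] H, ∑ i, LinearMap.mul' k k (TensorProduct.map (f.ofConv ∘ₗ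
      LinearMap.mulLeft k (y * antipode k (antipode k (e i))) ∘ₗ antipode k) (p i).ofConv w) =
      f (y * antipode k (LinearMap.mul' k H ((antipode k).lTensor H w))) := by
    intro w
    induction w with
    | zero => simp
    | add a b ha hb => simp only [map_add, Finset.sum_add_distrib, mul_add, ha, hb]
    | tmul a b =>
      simp only [LinearMap.lTensor_tmul, LinearMap.mul'_apply,
        HopfAlgebra.antipode_mul_antidistrib]
      conv_rhs => rw [← hp b]
      simp only [map_sum, map_smul, Finset.mul_sum, Finset.sum_mul, smul_mul_assoc,
        mul_smul_comm, TensorProduct.map_tmul, LinearMap.mul'_apply]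
      refine Finset.sum_congr rfl fun i _ => ?_
      simp [mul_comm]
  simp only [WithConv.ofConv_sum, LinearMap.sum_apply, LinearMap.convMul_apply]
  refine (h1 _).trans ?_
  rw [HopfAlgebra.mul_antipode_lTensor_comul_apply, Algebra.algebraMap_eq_smul_one, map_smul,
    HopfAlgebra.antipode_one, mul_smul_comm, mul_one, map_smul]
  simp [mul_comm]

/-- The module is a retract of kⁿ: the images of the standard basis and the coordinates of the
section are dual bases. -/
theorem exists_dual_bases (k M : Type*) [CommRing k] [AddCommGroup M] [Module k M]
    [Module.Finite k M] [Module.Projective k M] :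
    ∃ (n : ℕ) (e : Fin n → M) (p : Fin n → M →ₗ[k] k), ∀ m, ∑ i, p i m • e i = m := by
  obtain ⟨n, s, t, -, -, hst⟩ := Module.Finite.exists_comp_eq_id_of_projective k M
  refine ⟨n, fun i => s (Pi.single i 1), fun i => LinearMap.proj i ∘ₗ t, fun m => ?_⟩
  conv_rhs => rw [← LinearMap.id_apply (R := k) m, ← hst, LinearMap.comp_apply,
    pi_eq_sum_univ' (t m), map_sum]
  refine Finset.sum_congr rfl fun i _ => ?_
  rw [map_smul]
  congr 2

variable (k H) in
-- An integral θ makes θ(x S(h₁)) h₂ a linear function of S(h). Suitable choices of x, corrected by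
-- `hitRight (p i)`, add up to h itself.
theorem exists_comp_antipode_eq_id [Module.Finite k H] [Module.Projective k H] :
    ∃ R : H →ₗ[k] H, R ∘ₗ antipode k = LinearMap.id := by
  obtain ⟨n, e, p', hp'⟩ := exists_dual_bases k H
  let p : Fin n → WithConv (H →ₗ[k] k) := fun i => toConv (p' i)
  have hp : ∀ h, ∑ i, p i h • e i = h := hp'
  let θ : Fin n → WithConv (H →ₗ[k] k) := fun j => traceForm e p (p j)
  let f : Fin n → Fin n → WithConv (H →ₗ[k] k) := fun j i => toConv ((θ j).ofConv ∘ₗ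
    LinearMap.mulLeft k (antipode k (e j) * antipode k (antipode k (e i))) ∘ₗ antipode k)
  -- The factor S²(eᵢ) is matched with pᵢ(h₂) so that S²(h₂) S(h₁) collapses; the factor S(eⱼ) is
  -- there for the normalisation ∑ θⱼ(S(eⱼ)) = 1.
  refine ⟨∑ j, ∑ i, (hitRight (p i)).ofConv ∘ₗ
    hitMul (θ j) (antipode k (e j) * antipode k (antipode k (e i))), LinearMap.ext fun h => ?_⟩
  -- The integral property turns the first convolution factor in `hitMul_antipode` into a scalar.
  have h1 : ∀ j x, hitMul (θ j) x (antipode k h) =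
      hitRight (toConv ((θ j).ofConv ∘ₗ LinearMap.mulLeft k x ∘ₗ antipode k)) h := by
    intro j x
    have h2 := congrArg (fun F => F.ofConv h) (hitMul_antipode (θ j) x)
    refine h2.trans ?_
    rw [hitLeft_traceForm hp]
    rfl
  have h3 : ∑ j, ∑ i, f j i * p i = 1 := by
    have : ∀ j, ∑ i, f j i * p i = θ j (antipode k (e j)) • 1 := fun j =>
      sum_mulLeft_antipode_mul hp (θ j) (antipode k (e j))
    simp only [this]
    rw [← Finset.sum_smul, sum_traceForm_antipode hp, one_smul]
  calc _ = ∑ j, ∑ i, hitRight (f j i * p i) h := by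
        simp only [LinearMap.comp_apply, LinearMap.sum_apply, h1, ← hitRight_hitRight]
        rfl
    _ = (hitRight (∑ j, ∑ i, f j i * p i)).ofConv h := by
        simp only [hitRight, map_sum, Finset.sum_mul, WithConv.ofConv_sum, LinearMap.sum_apply]
    _ = h := by rw [h3, hitRight, scalarConv_one, one_mul]; rfl

variable (k H) in
/-- The antipode of a finitely generated projective Hopf algebra is bijective. -/
theorem antipode_bijective [Module.Finite k H] [Module.Projective k H] :
    Function.Bijective (antipode k : H →ₗ[k] H) := by
  obtain ⟨R, hR⟩ := exists_comp_antipode_eq_id k H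
  have hR' : Function.LeftInverse R (antipode k : H →ₗ[k] H) := LinearMap.congr_fun hR
  -- A surjective endomorphism of a finite module over a commutative ring is injective. So the left
  -- inverse R is bijective, and S is its two-sided inverse.
  have hb := OrzechProperty.bijective_of_surjective_endomorphism R hR'.surjective
  exact ⟨hR'.injective, (hR'.rightInverse_of_injective hb.injective).surjective⟩

end Integral

/-! ### The inverse antipode -/

section AntipodeInv

variable {k H : Type*} [CommRing k] [Ring H] [HopfAlgebra k H] [Module.Finite k H]
variable [Module.Projective k H]

variable (k) in
/-- The inverse of the antipode of a finitely generated projective Hopf algebra. -/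
noncomputable def antipodeInv : H →ₗ[k] H :=
  (LinearEquiv.ofBijective (antipode k) (antipode_bijective k H)).symm.toLinearMap

theorem antipodeInv_antipode (h : H) : antipodeInv k (antipode k h) = h :=
  (LinearEquiv.ofBijective (antipode k) (antipode_bijective k H)).symm_apply_apply h

theorem antipode_antipodeInv (h : H) : antipode k (antipodeInv k h) = h :=
  (LinearEquiv.ofBijective (antipode k) (antipode_bijective k H)).apply_symm_apply h

theorem antipodeInv_mul (x y : H) :
    antipodeInv k (x * y) = antipodeInv k y * antipodeInv k x := by
  apply (antipode_bijective k H).injective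
  rw [HopfAlgebra.antipode_mul_antidistrib]
  simp only [antipode_antipodeInv]

theorem counit_antipodeInv (x : H) : counit (R := k) (antipodeInv k x) = counit x := by
  conv_rhs => rw [← antipode_antipodeInv (k := k) x, HopfAlgebra.counit_antipode]

/-- Write x = S(S⁻¹(x)) on the right and use that S reverses Δ. -/
theorem comul_antipodeInv (x : H) :
    comul (antipodeInv k x) =
      TensorProduct.map (antipodeInv k) (antipodeInv k) (TensorProduct.comm k H H (comul x)) := by
  conv_rhs => rw [← antipode_antipodeInv (k := k) x, comul_antipode]
  generalize (comul (antipodeInv k x) : H ⊗[k] H) = w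
  induction w with
  | zero => simp
  | add a b ha hb => simp only [map_add, ← ha, ← hb]
  | tmul a b => simp [antipodeInv_antipode]

/-- `S⁻¹(x₂) x₁ = ε(x)` -/
theorem antipodeInv_mul_comul (x : H) :
    LinearMap.mul' k H (TensorProduct.map (antipodeInv k) LinearMap.id
      (TensorProduct.comm k H H (comul x))) = algebraMap k H (counit x) := by
  -- Applying S turns S⁻¹(x₂) x₁ into S(x₁) x₂.
  apply (antipode_bijective k H).injective
  rw [Algebra.algebraMap_eq_smul_one, map_smul, HopfAlgebra.antipode_one,
    ← Algebra.algebraMap_eq_smul_one, ← HopfAlgebra.mul_antipode_rTensor_comul_apply]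
  generalize (comul x : H ⊗[k] H) = w
  induction w with
  | zero => simp
  | add a b ha hb => simp only [map_add, ha, hb]
  | tmul a b => simp [HopfAlgebra.antipode_mul_antidistrib, antipode_antipodeInv]

/-- `x₂ S⁻¹(x₁) = ε(x)` -/
theorem mul_antipodeInv_comul (x : H) :
    LinearMap.mul' k H (TensorProduct.map LinearMap.id (antipodeInv k)
      (TensorProduct.comm k H H (comul x))) = algebraMap k H (counit x) := by
  -- Applying S turns x₂ S⁻¹(x₁) into x₁ S(x₂).
  apply (antipode_bijective k H).injective
  rw [Algebra.algebraMap_eq_smul_one, map_smul, HopfAlgebra.antipode_one,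
    ← Algebra.algebraMap_eq_smul_one, ← HopfAlgebra.mul_antipode_lTensor_comul_apply]
  generalize (comul x : H ⊗[k] H) = w
  induction w with
  | zero => simp
  | add a b ha hb => simp only [map_add, ha, hb]
  | tmul a b => simp [HopfAlgebra.antipode_mul_antidistrib, antipode_antipodeInv]

end AntipodeInv

/-! ### Comodule axioms and elements of the coring -/

section Coaction

variable {k H A : Type*} [CommRing k] [Ring H] [Bialgebra k H] [Ring A] [Algebra k A]
variable [ComoduleAlgebra k H A]

theorem assoc_rTensor_coact (a : A) :
    TensorProduct.assoc k A H H ((coact k H A).toLinearMap.rTensor H (coact k H A a)) =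
      (comul : H →ₗ[k] H ⊗[k] H).lTensor A (coact k H A a) :=
  ComoduleAlgebra.coassoc a

theorem rid_lTensor_counit_coact (a : A) :
    TensorProduct.rid k A ((counit : H →ₗ[k] k).lTensor A (coact k H A a)) = a :=
  ComoduleAlgebra.counit_coact a

namespace TensorCoring

theorem comul_tmul (a : A) (h : H) :
    (Coring.comul (tmul a h : TensorCoring k H A) :
      BalTensor A (TensorCoring k H A) (TensorCoring k H A)) = insert (a ⊗ₜ[k] comul h) := rfl

omit [ComoduleAlgebra k H A] in
theorem tmul_add (a : A) (h h' : H) :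
    (tmul a (h + h') : TensorCoring k H A) = tmul a h + tmul a h' := by
  rw [tmul, TensorProduct.tmul_add, map_add, tmul, tmul]

omit [ComoduleAlgebra k H A] in
theorem tmul_smul (r : k) (a : A) (h : H) :
    (tmul a (r • h) : TensorCoring k H A) = algebraMap k A r • tmul a h := by
  rw [tmul, tmul, ← map_smul, algebraMap_smul, TensorProduct.tmul_smul]

/-- Right linear forms can only release a scalar of k written as a right multiplication. This is
possible because the coaction fixes scalars. -/
theorem tmul_smul_right (r : k) (a : A) (h : H) :
    (tmul a (r • h) : TensorCoring k H A) = op (algebraMap k A r) • tmul a h := by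
  rw [tmul, tmul, op_algebraMap_smul, TensorProduct.tmul_smul]

end TensorCoring

end Coaction

/-! ### The isomorphism between A # H* and #(H, A) -/

section SmashEquiv

variable {k H A : Type*} [CommRing k] [Ring H] [Bialgebra k H] [Ring A] [Algebra k A]

variable (k H A) in
/-- The linear map `A ⊗ H* → Hom(H, A)`, `a ⊗ p ↦ p(-) a`. -/
noncomputable def tensorHom : A ⊗[k] DualAlg k H →ₗ[k] H →ₗ[k] A :=
  TensorProduct.lift <| LinearMap.mk₂ k
    (fun a p => LinearMap.toSpanSingleton k A a ∘ₗ DualAlg.of.symm p)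
    (fun a a' p => by ext; simp)
    (fun r a p => by ext; simp [smul_comm r])
    (fun a p p' => by ext; simp [add_smul])
    (fun r a p => by ext; simp [mul_smul])

theorem tensorHom_tmul (a : A) (p : DualAlg k H) (h : H) :
    tensorHom k H A (a ⊗ₜ[k] p) h = p h • a := rfl

theorem tensorHom_sum {n : ℕ} {e : Fin n → H} {p : Fin n → H →ₗ[k] k}
    (hp : ∀ h, ∑ i, p i h • e i = h) (f : H →ₗ[k] A) :
    tensorHom k H A (∑ i, f (e i) ⊗ₜ[k] DualAlg.of (p i)) = f := by
  ext h
  conv_rhs => rw [← hp h]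
  simp [tensorHom_tmul]

/-- Dual bases give the inverse f ↦ ∑ f(eᵢ) ⊗ pᵢ: one composite is f(h) = ∑ pᵢ(h) f(eᵢ), the other
is the expansion q = ∑ q(eᵢ) pᵢ in H*. -/
theorem tensorHom_bijective [Module.Finite k H] [Module.Projective k H] :
    Function.Bijective (tensorHom k H A) := by
  obtain ⟨n, e, p, hp⟩ := exists_dual_bases k H
  have hq : ∀ q : DualAlg k H, ∑ i, q (e i) • DualAlg.of (p i) = q := fun q =>
    DualAlg.ext' fun x => by
      conv_rhs => rw [← hp x]
      simp [mul_comm]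
  have hl : ∀ x : A ⊗[k] DualAlg k H,
      ∑ i, tensorHom k H A x (e i) ⊗ₜ[k] DualAlg.of (p i) = x := by
    intro x
    induction x with
    | zero => simp
    | add x y hx hy =>
      simp only [map_add, LinearMap.add_apply, TensorProduct.add_tmul, Finset.sum_add_distrib,
        hx, hy]
    | tmul a q =>
      conv_rhs => rw [← hq q]
      simp only [tensorHom_tmul, TensorProduct.tmul_sum, TensorProduct.smul_tmul]
  refine ⟨fun x y hxy => ?_, fun f => ⟨_, tensorHom_sum hp f⟩⟩
  rw [← hl x, ← hl y, hxy]

variable [ComoduleAlgebra k H A]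

/-- On a ⊗ p and b ⊗ q both sides are p(b₁ h₁) q(h₂) a b₀. -/
theorem tensorHom_mulₗ (x y : A ⊗[k] DualAlg k H) (h : H) :
    tensorHom k H A (Smash.mulₗ x y) h =
      BigSmash.mulAux (tensorHom k H A x) (tensorHom k H A y) (comul h) := by
  induction x with
  | zero =>
    have h0 := BigSmash.mulAux_add_left (0 : H →ₗ[k] A) 0 (tensorHom k H A y)
    rw [add_zero, left_eq_add] at h0
    simp [h0]
  | add x x' hx hx' =>
    simp only [map_add, LinearMap.add_apply, BigSmash.mulAux_add_left, hx, hx']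
  | tmul a p =>
    induction y with
    | zero =>
      have h0 := BigSmash.mulAux_add_right (tensorHom k H A (a ⊗ₜ p)) (0 : H →ₗ[k] A) 0
      rw [add_zero, left_eq_add] at h0
      simp [h0]
    | add y y' hy hy' =>
      simp only [map_add, LinearMap.add_apply, BigSmash.mulAux_add_right, hy, hy']
    | tmul b q =>
      let F : H →ₗ[k] A := tensorHom k H A (a ⊗ₜ[k] p)
      -- The coaction of b enters linearly, so it can be replaced by an arbitrary w and then by a
      -- pure tensor.
      have hw : ∀ w : A ⊗[k] H, tensorHom k H A ((a ⊗ₜ[k] (1 : DualAlg k H)) *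
          ((DualAlg.hit p).lTensor A w * ((1 : A) ⊗ₜ[k] q))) h =
          LinearMap.mul' k A (TensorProduct.map ((twistₗ F).flip w)
            (Algebra.linearMap k A ∘ₗ DualAlg.of.symm q) (comul h)) := by
        intro w
        induction w with
        | zero => simp
        | add w w' hw hw' =>
          simp only [map_add, mul_add, add_mul, LinearMap.add_apply, TensorProduct.map_add_left,
            hw, hw']
        | tmul c y =>
          rw [LinearMap.lTensor_tmul, Algebra.TensorProduct.tmul_mul_tmul,
            Algebra.TensorProduct.tmul_mul_tmul, one_mul, mul_one, tensorHom_tmul,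
            DualAlg.mul_apply]
          generalize (comul h : H ⊗[k] H) = v
          induction v with
          | zero => simp
          | add v v' hv hv' => simp only [map_add, add_smul, hv, hv']
          | tmul s t =>
            rw [TensorProduct.map_tmul, TensorProduct.map_tmul, LinearMap.mul'_apply,
              LinearMap.mul'_apply, LinearMap.flip_apply, twistₗ_tmul, tensorHom_tmul,
              DualAlg.hit_apply, LinearMap.comp_apply, Algebra.linearMap_apply,
              ← Algebra.commutes, ← Algebra.smul_def, smul_mul_assoc, smul_smul, mul_comm]
      rw [Smash.mulₗ_tmul, Smash.lmulDual_tmul, hw]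
      generalize (comul h : H ⊗[k] H) = v
      induction v with
      | zero => simp
      | add v v' hv hv' => simp only [map_add, hv, hv']
      | tmul s t =>
        rw [TensorProduct.map_tmul, LinearMap.mul'_apply, LinearMap.flip_apply,
          BigSmash.mulAux_tmul, tensorHom_tmul, LinearMap.comp_apply, Algebra.linearMap_apply,
          ← Algebra.commutes, ← Algebra.smul_def, map_smul, map_smul]

variable (k H A) in
/-- The ring isomorphism `A # H* ≃ #(H, A)`, `a # p ↦ p(-) a`. -/
noncomputable def smashEquiv [Module.Finite k H] [Module.Projective k H] :
    Smash k H A ≃+* BigSmash k H A :=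
  RingEquiv.mk
    ((Smash.equiv.trans (Equiv.ofBijective _ (tensorHom_bijective (k := k)))).trans
      BigSmash.equiv.symm)
    (fun x y => BigSmash.ext (LinearMap.ext fun h =>
      tensorHom_mulₗ x.toTensor y.toTensor h))
    (fun x y => BigSmash.ext (map_add (tensorHom k H A) x.toTensor y.toTensor))

theorem smashEquiv_toLin [Module.Finite k H] [Module.Projective k H] (x : Smash k H A) :
    (smashEquiv k H A x).toLin = tensorHom k H A x.toTensor := rfl

theorem Smash.toTensor_sum {ι : Type*} (s : Finset ι) (f : ι → Smash k H A) :
    (∑ i ∈ s, f i).toTensor = ∑ i ∈ s, (f i).toTensor :=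
  map_sum (AddMonoidHom.mk' Smash.toTensor fun _ _ => rfl) f s

/-- Whatever the dual bases, the sum is sent back to f, so injectivity gives the formula for all of
them at once. -/
theorem smashEquiv_symm_eq_sum [Module.Finite k H] [Module.Projective k H] {n : ℕ}
    {e : Fin n → H} {p : Fin n → H →ₗ[k] k} (hp : ∀ h, ∑ i, p i h • e i = h)
    (f : BigSmash k H A) :
    (smashEquiv k H A).symm f = ∑ i, Smash.tmul (f (e i)) (DualAlg.of (p i)) := by
  rw [RingEquiv.symm_apply_eq]
  refine BigSmash.ext ?_
  rw [smashEquiv_toLin, Smash.toTensor_sum]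
  exact (tensorHom_sum hp f.toLin).symm

end SmashEquiv

open _root_.HopfCoring.TensorCoring (of tmul exists_of)

/-! ### The isomorphism between (A ⊗ H)* and #(H, A) -/

section RightDualEquiv

variable {k H A : Type*} [CommRing k] [Ring H] [HopfAlgebra k H] [Ring A] [Algebra k A]
variable [ComoduleAlgebra k H A]

omit [ComoduleAlgebra k H A] in
theorem twistₗ_mul_tmul (f : H →ₗ[k] A) (u : H) (x : A ⊗[k] H) (b : A) (y : H) :
    twistₗ f u (x * (b ⊗ₜ[k] y)) = twistₗ f (y * u) x * b := by
  induction x with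
  | zero => simp
  | tmul c t => simp [twistₗ_tmul, mul_assoc]
  | add x y hx hy => simp only [map_add, add_mul, hx, hy]

/-- The linear map `A ⊗ H → A`, `a ⊗ h ↦ f(a₁ S(h)) a₀`. -/
noncomputable def antipodeTwist (f : H →ₗ[k] A) : A ⊗[k] H →ₗ[k] A :=
  TensorProduct.lift (((twistₗ f).flip ∘ₗ (coact k H A).toLinearMap).compl₂ (antipode k))

theorem antipodeTwist_tmul (f : H →ₗ[k] A) (a : A) (h : H) :
    antipodeTwist f (a ⊗ₜ[k] h) = twistₗ f (antipode k h) (coact k H A a) := rfl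

/-- This is right A-linearity. For x = a ⊗ h the left side is f(a₁ b₁ S(h b₂)) a₀ b₀ = f(a₁ b₁ S(b₂)
S(h)) a₀ b₀, and b₁ S(b₂) collapses to ε. -/
theorem antipodeTwist_mul_coact (f : H →ₗ[k] A) (x : A ⊗[k] H) (b : A) :
    antipodeTwist f (x * coact k H A b) = antipodeTwist f x * b := by
  induction x with
  | zero => simp
  | add x y hx hy => simp only [map_add, add_mul, hx, hy]
  | tmul a h =>
    let G : H ⊗[k] H →ₗ[k] A := (twistₗ f).flip (coact k H A a) ∘ₗ
      LinearMap.mulRight k (antipode k h) ∘ₗ LinearMap.mul' k H ∘ₗ (antipode k).lTensor H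
    -- `Q` sends c ⊗ s ⊗ t to f(a₁ s S(t) S(h)) a₀ c. It will be evaluated at b₀ ⊗ b₁ ⊗ b₂, once
    -- coassociativity has brought the coaction of b to that form.
    let Q : A ⊗[k] (H ⊗[k] H) →ₗ[k] A := TensorProduct.lift ((LinearMap.mul k A).flip.compl₂ G)
    have hQ : ∀ (c : A) (t : H ⊗[k] H), Q (c ⊗ₜ[k] t) =
        twistₗ f (LinearMap.mul' k H ((antipode k).lTensor H t) * antipode k h) (coact k H A a) *
          c := fun c t => rfl
    have h1 : ∀ w : A ⊗[k] H, antipodeTwist f ((a ⊗ₜ[k] h) * w) =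
        Q (TensorProduct.assoc k A H H ((coact k H A).toLinearMap.rTensor H w)) := by
      intro w
      induction w with
      | zero => simp
      | add x y hx hy => simp only [map_add, mul_add, hx, hy]
      | tmul c d =>
        rw [Algebra.TensorProduct.tmul_mul_tmul, antipodeTwist_tmul, map_mul (coact k H A),
          HopfAlgebra.antipode_mul_antidistrib, LinearMap.rTensor_tmul, AlgHom.toLinearMap_apply]
        generalize coact k H A c = v
        induction v with
        | zero => simp
        | add x y hx hy => simp only [map_add, mul_add, TensorProduct.add_tmul, hx, hy]
        | tmul c' d' =>
          rw [twistₗ_mul_tmul, TensorProduct.assoc_tmul, hQ, LinearMap.lTensor_tmul,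
            LinearMap.mul'_apply, mul_assoc]
    have h2 : ∀ w : A ⊗[k] H, Q ((comul : H →ₗ[k] H ⊗[k] H).lTensor A w) =
        twistₗ f (antipode k h) (coact k H A a) *
          TensorProduct.rid k A ((counit : H →ₗ[k] k).lTensor A w) := by
      intro w
      induction w with
      | zero => simp
      | add x y hx hy => simp only [map_add, mul_add, hx, hy]
      | tmul c d =>
        rw [LinearMap.lTensor_tmul, hQ, HopfAlgebra.mul_antipode_lTensor_comul_apply,
          ← Algebra.smul_def]
        simp
    rw [h1, assoc_rTensor_coact, h2, rid_lTensor_counit_coact, antipodeTwist_tmul]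

/-- The right linear form `a ⊗ h ↦ f(a₁ S(h)) a₀` on `A ⊗ H`. -/
noncomputable def rightDualOf (f : BigSmash k H A) : RightDual A (TensorCoring k H A) where
  toLin :=
    { toFun := fun x => antipodeTwist f.toLin (of.symm x)
      map_add' := fun x y => by rw [map_add, map_add]
      map_smul' := fun b x => antipodeTwist_mul_coact f.toLin _ _ }

theorem rightDualOf_of (f : BigSmash k H A) (x : A ⊗[k] H) :
    rightDualOf f (of x) = antipodeTwist f.toLin x := rfl

variable [Module.Finite k H] [Module.Projective k H]

/-- The linear map `h ↦ φ(1 ⊗ S⁻¹(h))`. -/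
noncomputable def bigSmashOf (φ : RightDual A (TensorCoring k H A)) : BigSmash k H A where
  toLin :=
    { toFun := fun h => φ (tmul 1 (antipodeInv k h))
      map_add' := fun h h' => by rw [map_add, TensorCoring.tmul_add, map_add]
      map_smul' := fun r h => by
        rw [map_smul, TensorCoring.tmul_smul_right, map_smul, RingHom.id_apply, op_smul_eq_mul,
          ← Algebra.commutes, Algebra.smul_def] }

theorem bigSmashOf_apply (φ : RightDual A (TensorCoring k H A)) (h : H) :
    bigSmashOf φ h = φ (tmul 1 (antipodeInv k h)) := rfl

/-- For x = a ⊗ h, right linearity of φ gives φ(1 ⊗ S⁻¹(a₁ S(h))) a₀ = φ((1 ⊗ h S⁻¹(a₁)) a₀) = φ(a₀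
⊗ h S⁻¹(a₂) a₁), which is φ(a ⊗ h). It serves both as an inverse relation and in the
multiplicativity of γ. -/
theorem antipodeTwist_bigSmashOf (φ : RightDual A (TensorCoring k H A)) (x : A ⊗[k] H) :
    antipodeTwist (bigSmashOf φ).toLin x = φ (of x) := by
  induction x with
  | zero => simp
  | add x y hx hy => simp only [map_add, hx, hy]
  | tmul a h =>
    -- `q` is s ⊗ t ↦ h S⁻¹(t) s, so that `q (comul d)` equals ε(d) h.
    let q : H ⊗[k] H →ₗ[k] H := LinearMap.mulLeft k h ∘ₗ LinearMap.mul' k H ∘ₗ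
      TensorProduct.map (antipodeInv k) LinearMap.id ∘ₗ (TensorProduct.comm k H H).toLinearMap
    have h1 : ∀ w : A ⊗[k] H, twistₗ (bigSmashOf φ).toLin (antipode k h) w =
        φ (of (q.lTensor A (TensorProduct.assoc k A H H
          ((coact k H A).toLinearMap.rTensor H w)))) := by
      intro w
      induction w with
      | zero => simp
      | add x y hx hy => simp only [map_add, hx, hy]
      | tmul c d =>
        have h3 : ∀ v : A ⊗[k] H, ((1 : A) ⊗ₜ[k] (h * antipodeInv k d)) * v =
            q.lTensor A (TensorProduct.assoc k A H H (v ⊗ₜ[k] d)) := by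
          intro v
          induction v with
          | zero => simp
          | add x y hx hy => simp only [map_add, mul_add, TensorProduct.add_tmul, hx, hy]
          | tmul c' d' => simp [q, mul_assoc]
        rw [twistₗ_tmul, bigSmashOf_apply, antipodeInv_mul, antipodeInv_antipode]
        refine ((map_smul φ.toLin (op c) _).symm).trans ?_
        rw [LinearMap.rTensor_tmul, AlgHom.toLinearMap_apply, ← h3]
        rfl
    have h2 : ∀ w : A ⊗[k] H, q.lTensor A ((comul : H →ₗ[k] H ⊗[k] H).lTensor A w) =
        (TensorProduct.rid k A ((counit : H →ₗ[k] k).lTensor A w)) ⊗ₜ[k] h := by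
      intro w
      induction w with
      | zero => simp
      | add x y hx hy => simp only [map_add, TensorProduct.add_tmul, hx, hy]
      | tmul c d =>
        have hq : q (comul d) = counit (R := k) d • h := by
          refine (congrArg (fun z => h * z) (antipodeInv_mul_comul d)).trans ?_
          rw [← Algebra.commutes, Algebra.smul_def]
        rw [LinearMap.lTensor_tmul, LinearMap.lTensor_tmul, hq]
        simp [TensorProduct.smul_tmul]
    rw [antipodeTwist_tmul, h1, assoc_rTensor_coact, h2, rid_lTensor_counit_coact]

/-- As S⁻¹ reverses Δ, the left side at h is φ(ψ(1 ⊗ S⁻¹(h₂)) ⊗ S⁻¹(h₁)). Rewriting φ through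
`antipodeTwist` replaces S⁻¹(h₁) by h₁ and yields the product of #(H, A). -/
theorem bigSmashOf_mul (φ ψ : RightDual A (TensorCoring k H A)) :
    bigSmashOf (φ * ψ) = bigSmashOf φ * bigSmashOf ψ := by
  refine BigSmash.ext' fun h => ?_
  rw [bigSmashOf_apply, RightDual.mul_apply, TensorCoring.comul_tmul, comul_antipodeInv,
    BigSmash.mul_apply]
  generalize (comul h : H ⊗[k] H) = v
  induction v with
  | zero => simp
  | add x y hx hy => simp only [map_add, TensorProduct.tmul_add, hx, hy]
  | tmul s t =>
    rw [BigSmash.mulAux_tmul, TensorProduct.comm_tmul, TensorProduct.map_tmul,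
      TensorCoring.insert_tmul, BalTensor.contractLeft_tmul]
    have h1 : ψ (tmul 1 (antipodeInv k t)) • (tmul 1 (antipodeInv k s) : TensorCoring k H A) =
        of (bigSmashOf ψ t ⊗ₜ[k] antipodeInv k s) := by
      refine ((map_smul of (ψ (tmul 1 (antipodeInv k t))) _).symm).trans ?_
      rw [TensorProduct.smul_tmul', smul_eq_mul, mul_one]
      rfl
    rw [h1, ← antipodeTwist_bigSmashOf, antipodeTwist_tmul, antipode_antipodeInv]

variable (k H A) in
/-- The ring isomorphism `(A ⊗ H)* ≃ #(H, A)`. -/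
noncomputable def rightDualEquiv : RightDual A (TensorCoring k H A) ≃+* BigSmash k H A where
  toFun := bigSmashOf
  invFun := rightDualOf
  left_inv φ := RightDual.ext' fun x => by
    obtain ⟨x, rfl⟩ := exists_of x
    rw [rightDualOf_of, antipodeTwist_bigSmashOf]
  right_inv f := BigSmash.ext' fun h => by
    rw [bigSmashOf_apply, tmul, rightDualOf_of, antipodeTwist_tmul, antipode_antipodeInv, map_one,
      Algebra.TensorProduct.one_def, twistₗ_tmul, one_mul, mul_one]
  map_mul' := bigSmashOf_mul
  map_add' φ ψ := rfl

end RightDualEquiv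

/-! ### The isomorphism between A # H* and *(A ⊗ H) -/

section LeftDualEquiv

variable {k H A : Type*} [CommRing k] [Ring H] [Ring A] [Algebra k A]

section Bialgebra

variable [Bialgebra k H]

/-- The left linear form `a ⊗ h ↦ a f(h)` on `A ⊗ H`. -/
noncomputable def leftDualOf (f : H →ₗ[k] A) : LeftDual A (TensorCoring k H A) where
  toLin :=
    { toFun := fun x => LinearMap.mul' k A (f.lTensor A (of.symm x))
      map_add' := fun x y => by rw [map_add, map_add, map_add]
      map_smul' := fun a x => by
        obtain ⟨x, rfl⟩ := exists_of x
        rw [map_smul, LinearEquiv.symm_apply_apply, RingHom.id_apply]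
        induction x with
        | zero => simp
        | add x y hx hy => simp only [smul_add, map_add, hx, hy]
        | tmul b h => simp [TensorProduct.smul_tmul', mul_assoc] }

theorem leftDualOf_tmul (f : H →ₗ[k] A) (a : A) (h : H) :
    leftDualOf f (tmul a h) = a * f h := rfl

theorem LeftDual.ext_tmul_one {φ ψ : LeftDual A (TensorCoring k H A)}
    (hφ : ∀ h, φ (tmul 1 h) = ψ (tmul 1 h)) : φ = ψ := by
  refine LeftDual.ext' fun x => ?_
  obtain ⟨x, rfl⟩ := exists_of x
  induction x with
  | zero => simp
  | add x y hx hy => simp only [map_add, hx, hy]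
  | tmul a h =>
    have ha : (of (a ⊗ₜ[k] h) : TensorCoring k H A) = a • tmul 1 h := by
      refine Eq.trans ?_ (map_smul of a ((1 : A) ⊗ₜ[k] h))
      rw [TensorProduct.smul_tmul', smul_eq_mul, mul_one]
    rw [ha, map_smul, map_smul, hφ]

theorem leftDualOf_add (f g : H →ₗ[k] A) : leftDualOf (f + g) = leftDualOf f + leftDualOf g :=
  LeftDual.ext_tmul_one fun h => by
    rw [LeftDual.toLin_add, LinearMap.add_apply]
    simp only [leftDualOf_tmul, LinearMap.add_apply, mul_add]

/-- A ⊗ H is generated as a left A-module by the elements 1 ⊗ h, so a left linear form is the same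
as its restriction to them. -/
theorem leftDualOf_bijective :
    Function.Bijective (leftDualOf : (H →ₗ[k] A) → LeftDual A (TensorCoring k H A)) := by
  refine ⟨fun f g hfg => LinearMap.ext fun h => ?_, fun φ => ?_⟩
  · have h1 := congrArg (fun φ : LeftDual A (TensorCoring k H A) => φ (tmul 1 h)) hfg
    simpa only [leftDualOf_tmul, one_mul] using h1
  · refine ⟨{ toFun := fun h => φ (tmul 1 h)
              map_add' := fun h h' => by rw [TensorCoring.tmul_add, map_add]
              map_smul' := fun r h => by
                rw [TensorCoring.tmul_smul, map_smul, RingHom.id_apply, smul_eq_mul,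
                  Algebra.smul_def] }, LeftDual.ext_tmul_one fun h => ?_⟩
    rw [leftDualOf_tmul, one_mul]
    rfl

variable [ComoduleAlgebra k H A]

/-- The linear map `a ⊗ p ↦ a₀ ⊗ B(p, a₁)`. -/
noncomputable def coactLift (B : DualAlg k H →ₗ[k] H →ₗ[k] DualAlg k H) :
    A ⊗[k] DualAlg k H →ₗ[k] A ⊗[k] DualAlg k H :=
  TensorProduct.lift ((LinearMap.lTensorHom A ∘ₗ B).flip ∘ₗ (coact k H A).toLinearMap)

theorem coactLift_tmul (B : DualAlg k H →ₗ[k] H →ₗ[k] DualAlg k H) (a : A) (p : DualAlg k H) :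
    coactLift B (a ⊗ₜ[k] p) = (B p).lTensor A (coact k H A a) := rfl

/-- Coassociativity: both sides are a₀ ⊗ B(b(a₂), a₁). The `flip` is there because the inner map
consumes the last leg. -/
theorem coactLift_lTensor_coact (B : DualAlg k H →ₗ[k] H →ₗ[k] DualAlg k H)
    (b : H →ₗ[k] DualAlg k H) (a : A) :
    coactLift B (b.lTensor A (coact k H A a)) =
      (TensorProduct.lift (B ∘ₗ b).flip ∘ₗ comul).lTensor A (coact k H A a) := by
  rw [LinearMap.lTensor_comp_apply, ← assoc_rTensor_coact]
  generalize coact k H A a = w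
  induction w with
  | zero => simp
  | add x y hx hy => simp only [map_add, hx, hy]
  | tmul c d =>
    rw [LinearMap.lTensor_tmul, coactLift_tmul, LinearMap.rTensor_tmul, AlgHom.toLinearMap_apply]
    generalize coact k H A c = v
    induction v with
    | zero => simp
    | add x y hx hy => simp only [map_add, TensorProduct.add_tmul, hx, hy]
    | tmul s t => rfl

/-- The composite is a ⊗ p ↦ a₀ ⊗ B(B'(p, a₂), a₁). The hypothesis reduces this to ε(a₁) a₀ ⊗ p, so
invertibility of the twist is a statement about H alone. -/
theorem coactLift_coactLift {B B' : DualAlg k H →ₗ[k] H →ₗ[k] DualAlg k H}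
    (hB : ∀ p y, TensorProduct.lift (B ∘ₗ B' p).flip (comul y) = counit (R := k) y • p)
    (x : A ⊗[k] DualAlg k H) : coactLift B (coactLift B' x) = x := by
  induction x with
  | zero => simp
  | add x y hx hy => simp only [map_add, hx, hy]
  | tmul a p =>
    have h1 : ∀ w : A ⊗[k] H, (TensorProduct.lift (B ∘ₗ B' p).flip ∘ₗ comul).lTensor A w =
        (TensorProduct.rid k A ((counit : H →ₗ[k] k).lTensor A w)) ⊗ₜ[k] p := by
      intro w
      induction w with
      | zero => simp
      | add x y hx hy => simp only [map_add, TensorProduct.add_tmul, hx, hy]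
      | tmul c d =>
        rw [LinearMap.lTensor_tmul, LinearMap.comp_apply, hB]
        simp [TensorProduct.smul_tmul]
    rw [coactLift_tmul, coactLift_lTensor_coact, h1, rid_lTensor_counit_coact]

theorem LeftDual.mul_apply_tmul_one (φ ψ : LeftDual A (TensorCoring k H A)) (h : H) :
    (φ * ψ) (tmul 1 h) = ψ (BalTensor.contractRight φ.toLin
      (TensorCoring.insert ((1 : A) ⊗ₜ[k] comul h))) := rfl

theorem contractRight_insert_tmul (φ : LeftDual A (TensorCoring k H A)) (s t : H) :
    (BalTensor.contractRight φ.toLin (TensorCoring.insert ((1 : A) ⊗ₜ[k] (s ⊗ₜ[k] t))) :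
      TensorCoring k H A) = of (((1 : A) ⊗ₜ[k] s) * coact k H A (φ (tmul 1 t))) := rfl

theorem Smash.toTensor_tmul_one_mul (a : A) (x : Smash k H A) :
    (Smash.tmul a 1 * x).toTensor = (a ⊗ₜ[k] (1 : DualAlg k H)) * x.toTensor := by
  have h1 := congrArg Smash.toTensor (one_mul x)
  rw [Smash.toTensor_mul, Smash.toTensor_one, Smash.mulₗ_tmul,
    ← Algebra.TensorProduct.one_def, one_mul] at h1
  rw [Smash.toTensor_mul]
  change Smash.mulₗ (a ⊗ₜ[k] 1) x.toTensor = _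
  rw [Smash.mulₗ_tmul, h1]

theorem Smash.toTensor_one_tmul_mul (p : DualAlg k H) (x : Smash k H A) :
    (Smash.tmul 1 p * x).toTensor = Smash.lmulDual p x.toTensor := by
  rw [Smash.toTensor_mul]
  change Smash.mulₗ (1 ⊗ₜ[k] p) x.toTensor = _
  rw [Smash.mulₗ_tmul, ← Algebra.TensorProduct.one_def, one_mul]

theorem Smash.tmul_eq_mul (a : A) (p : DualAlg k H) :
    (Smash.tmul a p : Smash k H A) = Smash.tmul a 1 * Smash.tmul 1 p := by
  refine Smash.ext ?_
  rw [Smash.toTensor_tmul_one_mul]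
  change a ⊗ₜ[k] p = (a ⊗ₜ[k] 1) * (1 ⊗ₜ[k] p)
  rw [Algebra.TensorProduct.tmul_mul_tmul, mul_one, one_mul]

@[elab_as_elim]
theorem Smash.induction {motive : Smash k H A → Prop} (x : Smash k H A) (zero : motive 0)
    (tmul : ∀ a p, motive (Smash.tmul a p))
    (add : ∀ x y, motive x → motive y → motive (x + y)) : motive x := by
  obtain ⟨t⟩ := x
  induction t with
  | zero => exact zero
  | tmul a p => exact tmul a p
  | add u v hu hv => exact add _ _ hu hv

end Bialgebra

variable [HopfAlgebra k H]

variable (k H) in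
/-- `antipodeHit p y` is the form `h ↦ p(S(y h))`. -/
noncomputable def antipodeHit : DualAlg k H →ₗ[k] H →ₗ[k] DualAlg k H :=
  DualAlg.hit ∘ₗ DualAlg.of.toLinearMap ∘ₗ LinearMap.lcomp k k (antipode k) ∘ₗ
    DualAlg.of.symm.toLinearMap

variable [Module.Finite k H] [Module.Projective k H]

variable (k H) in
/-- `invHit p y` is the form `h ↦ p(S⁻¹(h y))`. -/
noncomputable def invHit : DualAlg k H →ₗ[k] H →ₗ[k] DualAlg k H :=
  LinearMap.mk₂ k
    (fun p y => DualAlg.of (DualAlg.of.symm p ∘ₗ antipodeInv k ∘ₗ LinearMap.mulRight k y))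
    (fun p q y => rfl)
    (fun r p y => rfl)
    (fun p y z => DualAlg.ext' fun h => by simp [mul_add])
    (fun r p y => DualAlg.ext' fun h => by simp)

theorem invHit_apply (p : DualAlg k H) (y h : H) :
    invHit k H p y h = p (antipodeInv k (h * y)) := rfl

/-- At x the left side is p(S(y₂ S⁻¹(x y₁))) = p(x y₁ S(y₂)). -/
theorem invHit_antipodeHit_comul (p : DualAlg k H) (y : H) :
    TensorProduct.lift (invHit k H ∘ₗ antipodeHit k H p).flip (comul y) =
      counit (R := k) y • p := by
  refine DualAlg.ext' fun x => ?_
  have h1 : ∀ w : H ⊗[k] H, TensorProduct.lift (invHit k H ∘ₗ antipodeHit k H p).flip w x =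
      p (x * LinearMap.mul' k H ((antipode k).lTensor H w)) := by
    intro w
    induction w with
    | zero => simp
    | add a b ha hb => simp only [map_add, LinearMap.add_apply, mul_add, ha, hb]
    | tmul a b =>
      change p (antipode k (b * antipodeInv k (x * a))) = _
      rw [HopfAlgebra.antipode_mul_antidistrib, antipode_antipodeInv, LinearMap.lTensor_tmul,
        LinearMap.mul'_apply, mul_assoc]
  rw [h1, HopfAlgebra.mul_antipode_lTensor_comul_apply, ← Algebra.commutes, ← Algebra.smul_def,
    map_smul, map_smul, LinearMap.smul_apply]

/-- At x the left side is p(S⁻¹(S(y₁ x) y₂)) = p(S⁻¹(S(x) S(y₁) y₂)). -/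
theorem antipodeHit_invHit_comul (p : DualAlg k H) (y : H) :
    TensorProduct.lift (antipodeHit k H ∘ₗ invHit k H p).flip (comul y) =
      counit (R := k) y • p := by
  refine DualAlg.ext' fun x => ?_
  have h1 : ∀ w : H ⊗[k] H, TensorProduct.lift (antipodeHit k H ∘ₗ invHit k H p).flip w x =
      p (antipodeInv k (antipode k x * LinearMap.mul' k H ((antipode k).rTensor H w))) := by
    intro w
    induction w with
    | zero => simp
    | add a b ha hb => simp only [map_add, LinearMap.add_apply, mul_add, ha, hb]
    | tmul a b =>
      change p (antipodeInv k (antipode k (a * x) * b)) = _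
      rw [HopfAlgebra.antipode_mul_antidistrib, LinearMap.rTensor_tmul, LinearMap.mul'_apply,
        mul_assoc]
  rw [h1, HopfAlgebra.mul_antipode_rTensor_comul_apply, ← Algebra.commutes, ← Algebra.smul_def,
    map_smul, antipodeInv_antipode, map_smul, map_smul, LinearMap.smul_apply]

variable [ComoduleAlgebra k H A]

theorem coactLift_invHit_bijective :
    Function.Bijective (coactLift (A := A) (invHit k H)) :=
  Function.bijective_iff_has_inverse.2 ⟨coactLift (antipodeHit k H),
    coactLift_coactLift antipodeHit_invHit_comul, coactLift_coactLift invHit_antipodeHit_comul⟩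

variable (k H A) in
/-- The linear map `A ⊗ H* → Hom(H, A)`, `a ⊗ p ↦ (h ↦ p(S⁻¹(h a₁)) a₀)`. -/
noncomputable def invTensorHom : A ⊗[k] DualAlg k H →ₗ[k] H →ₗ[k] A :=
  tensorHom k H A ∘ₗ coactLift (invHit k H)

theorem invTensorHom_bijective : Function.Bijective (invTensorHom k H A) :=
  tensorHom_bijective.comp coactLift_invHit_bijective

theorem invTensorHom_tmul (a : A) (p : DualAlg k H) (h : H) :
    invTensorHom k H A (a ⊗ₜ[k] p) h =
      tensorHom k H A ((invHit k H p).lTensor A (coact k H A a)) h := rfl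

/-- The left linear form `b ⊗ h ↦ p(S⁻¹(h a₁)) b a₀` attached to `a # p`. -/
noncomputable def smashToLeftDual (x : Smash k H A) : LeftDual A (TensorCoring k H A) :=
  leftDualOf (invTensorHom k H A x.toTensor)

theorem smashToLeftDual_add (x y : Smash k H A) :
    smashToLeftDual (x + y) = smashToLeftDual x + smashToLeftDual y := by
  rw [smashToLeftDual, Smash.toTensor_add, map_add, leftDualOf_add]
  rfl

theorem smashToLeftDual_zero : smashToLeftDual (0 : Smash k H A) = 0 := by
  have h0 := smashToLeftDual_add (0 : Smash k H A) 0
  rwa [add_zero, left_eq_add] at h0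

theorem smashToLeftDual_bijective :
    Function.Bijective (smashToLeftDual : Smash k H A → LeftDual A (TensorCoring k H A)) :=
  leftDualOf_bijective.comp (invTensorHom_bijective.comp Smash.equiv.bijective)

theorem smashToLeftDual_apply (x : Smash k H A) (a : A) (h : H) :
    smashToLeftDual x (tmul a h) = a * invTensorHom k H A x.toTensor h := rfl

theorem invTensorHom_tmul_one (a : A) (h : H) :
    invTensorHom k H A (a ⊗ₜ[k] 1) h = counit (R := k) h • a := by
  have h1 : ∀ w : A ⊗[k] H, tensorHom k H A ((invHit k H 1).lTensor A w) h =
      counit (R := k) h • TensorProduct.rid k A ((counit : H →ₗ[k] k).lTensor A w) := by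
    intro w
    induction w with
    | zero => simp
    | add x y hx hy => simp only [map_add, LinearMap.add_apply, smul_add, hx, hy]
    | tmul c d =>
      rw [LinearMap.lTensor_tmul, tensorHom_tmul, invHit_apply, DualAlg.one_apply,
        counit_antipodeInv, Bialgebra.counit_mul, LinearMap.lTensor_tmul,
        TensorProduct.rid_tmul, mul_smul]
  rw [invTensorHom_tmul, h1, rid_lTensor_counit_coact]

theorem invTensorHom_one_tmul (p : DualAlg k H) (h : H) :
    invTensorHom k H A (1 ⊗ₜ[k] p) h = p (antipodeInv k h) • 1 := by
  rw [invTensorHom_tmul, map_one, Algebra.TensorProduct.one_def, LinearMap.lTensor_tmul,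
    tensorHom_tmul, invHit_apply, mul_one]

/-- For x = b ⊗ q both sides are q(S⁻¹(h a₁ b₁)) a₀ b₀, because the coaction is multiplicative. -/
theorem leftDualOf_mul_coact (x : A ⊗[k] DualAlg k H) (a : A) (h : H) :
    leftDualOf (invTensorHom k H A x) (of (((1 : A) ⊗ₜ[k] h) * coact k H A a)) =
      invTensorHom k H A ((a ⊗ₜ[k] (1 : DualAlg k H)) * x) h := by
  induction x with
  | zero =>
    rw [map_zero, mul_zero, map_zero]
    change LinearMap.mul' k A ((0 : H →ₗ[k] A).lTensor A _) = 0
    rw [LinearMap.lTensor_zero, LinearMap.zero_apply, map_zero]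
  | add x y hx hy =>
    rw [mul_add, map_add, map_add, LinearMap.add_apply, ← hx, ← hy, leftDualOf_add]
    rfl
  | tmul b q =>
    rw [Algebra.TensorProduct.tmul_mul_tmul, one_mul, invTensorHom_tmul, map_mul (coact k H A)]
    change LinearMap.mul' k A
      ((tensorHom k H A ((invHit k H q).lTensor A (coact k H A b))).lTensor A _) = _
    generalize coact k H A b = v
    generalize coact k H A a = w
    induction w with
    | zero => simp
    | add x y hx hy => simp only [mul_add, add_mul, map_add, LinearMap.add_apply, hx, hy]
    | tmul c d =>
      rw [Algebra.TensorProduct.tmul_mul_tmul, one_mul, LinearEquiv.symm_apply_apply,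
        LinearMap.lTensor_tmul, LinearMap.mul'_apply]
      induction v with
      | zero => simp
      | add x y hx hy => simp only [mul_add, map_add, LinearMap.add_apply, hx, hy]
      | tmul s t =>
        rw [Algebra.TensorProduct.tmul_mul_tmul, LinearMap.lTensor_tmul, LinearMap.lTensor_tmul,
          tensorHom_tmul, tensorHom_tmul, invHit_apply, invHit_apply, mul_smul_comm, mul_assoc]

/-- The form φ attached to a # 1 takes 1 ⊗ h to ε(h) a. Hence (1 ⊗ h₁) φ(1 ⊗ h₂) is (1 ⊗ h) a, and
`leftDualOf_mul_coact` applies. -/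
theorem smashToLeftDual_tmul_one_mul (a : A) (x : Smash k H A) :
    smashToLeftDual (Smash.tmul a 1 * x) =
      smashToLeftDual (Smash.tmul a 1) * smashToLeftDual x := by
  refine LeftDual.ext_tmul_one fun h => ?_
  have h1 : ∀ v : H ⊗[k] H, (BalTensor.contractRight
      (smashToLeftDual (Smash.tmul a 1 : Smash k H A)).toLin
      (TensorCoring.insert ((1 : A) ⊗ₜ[k] v)) : TensorCoring k H A) =
      of (((1 : A) ⊗ₜ[k] TensorProduct.rid k H ((counit : H →ₗ[k] k).lTensor H v)) *
        coact k H A a) := by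
    intro v
    induction v with
    | zero => simp
    | add x y hx hy => simp only [TensorProduct.tmul_add, map_add, add_mul, hx, hy]
    | tmul s t =>
      rw [contractRight_insert_tmul, smashToLeftDual_apply, one_mul]
      change of (_ * coact k H A (invTensorHom k H A (a ⊗ₜ[k] 1) t)) = _
      rw [invTensorHom_tmul_one, map_smul, mul_smul_comm, LinearMap.lTensor_tmul,
        TensorProduct.rid_tmul, TensorProduct.tmul_smul, smul_mul_assoc]
  rw [LeftDual.mul_apply_tmul_one, h1, Coalgebra.lTensor_counit_comul, TensorProduct.rid_tmul,
    one_smul, smashToLeftDual_apply, one_mul, Smash.toTensor_tmul_one_mul]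
  exact (leftDualOf_mul_coact x.toTensor a h).symm

/-- `(p(d₂ -) q)(S⁻¹(h d₁)) = q(S⁻¹(h₁ d)) p(S⁻¹(h₂))` -/
theorem invHit_hit_mul_comul (p q : DualAlg k H) (d h : H) :
    TensorProduct.lift (invHit k H ∘ₗ LinearMap.mulRight k q ∘ₗ DualAlg.hit p).flip (comul d) h =
      LinearMap.mul' k k (TensorProduct.map (DualAlg.of.symm (invHit k H q d))
        (DualAlg.of.symm p ∘ₗ antipodeInv k) (comul h)) := by
  -- `K` is evaluated with s, r the two legs of Δ(h) and x, y, z those of the iterated coproduct of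
  -- d. The factor z S⁻¹(y) = d₃ S⁻¹(d₂) is the one that cancels.
  let K : H → H → H ⊗[k] (H ⊗[k] H) →ₗ[k] k := fun s r => LinearMap.mul' k k ∘ₗ
    TensorProduct.map (DualAlg.of.symm q ∘ₗ antipodeInv k ∘ₗ LinearMap.mulLeft k s)
      (DualAlg.of.symm p ∘ₗ LinearMap.mulRight k (antipodeInv k r) ∘ₗ LinearMap.mul' k H ∘ₗ
        TensorProduct.map LinearMap.id (antipodeInv k) ∘ₗ
          (TensorProduct.comm k H H).toLinearMap)
  have hK : ∀ s r x y z, K s r (x ⊗ₜ[k] (y ⊗ₜ[k] z)) =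
      q (antipodeInv k (s * x)) * p (z * antipodeInv k y * antipodeInv k r) :=
    fun _ _ _ _ _ => rfl
  -- A fixed expression of Δ(h) as a sum keeps its legs as parameters while the inductions run over
  -- the coproducts of d.
  let R := Coalgebra.Repr.arbitrary k h
  have h1 : ∀ w : H ⊗[k] H,
      TensorProduct.lift (invHit k H ∘ₗ LinearMap.mulRight k q ∘ₗ DualAlg.hit p).flip w h =
      ∑ i ∈ R.index, K (R.left i) (R.right i)
        (TensorProduct.assoc k H H H ((comul : H →ₗ[k] H ⊗[k] H).rTensor H w)) := by
    intro w
    induction w with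
    | zero => simp
    | add x y hx hy =>
      simp only [map_add, LinearMap.add_apply, Finset.sum_add_distrib, hx, hy]
    | tmul y z =>
      change (DualAlg.hit p z * q) (antipodeInv k (h * y)) = _
      rw [DualAlg.mul_apply, comul_antipodeInv, Bialgebra.comul_mul, ← R.eq, Finset.sum_mul]
      simp only [map_sum, LinearMap.rTensor_tmul]
      refine Finset.sum_congr rfl fun i _ => ?_
      generalize (comul y : H ⊗[k] H) = u
      induction u with
      | zero => simp
      | add x y hx hy => simp only [map_add, mul_add, TensorProduct.add_tmul, hx, hy]
      | tmul a b =>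
        rw [Algebra.TensorProduct.tmul_mul_tmul, TensorProduct.comm_tmul, TensorProduct.map_tmul,
          TensorProduct.map_tmul, LinearMap.mul'_apply, TensorProduct.assoc_tmul, hK,
          DualAlg.hit_apply, antipodeInv_mul (R.right i), mul_assoc, mul_comm]
  have h2 : ∀ (s r : H) (w : H ⊗[k] H), K s r ((comul : H →ₗ[k] H ⊗[k] H).lTensor H w) =
      q (antipodeInv k (s * TensorProduct.rid k H ((counit : H →ₗ[k] k).lTensor H w))) *
        p (antipodeInv k r) := by
    intro s r w
    induction w with
    | zero => simp
    | add x y hx hy => simp only [map_add, mul_add, add_mul, hx, hy]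
    | tmul x y =>
      change q (antipodeInv k (s * x)) * p (LinearMap.mul' k H (TensorProduct.map LinearMap.id
        (antipodeInv k) (TensorProduct.comm k H H (comul y))) * antipodeInv k r) = _
      rw [mul_antipodeInv_comul, ← Algebra.smul_def]
      simp [mul_left_comm, mul_assoc]
  rw [h1, Coalgebra.coassoc_apply, ← R.eq]
  simp only [h2, Coalgebra.lTensor_counit_comul, TensorProduct.rid_tmul, one_smul, map_sum]
  rfl

/-- For x = b ⊗ q, coassociativity turns the left side into ((p ↼ b₂) q)(S⁻¹(h b₁)) b₀, to which
`invHit_hit_mul_comul` applies with d = b₁. The result is the value of b # q at h₁ times the scalar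
p(S⁻¹(h₂)). -/
theorem invTensorHom_lmulDual (p : DualAlg k H) (x : A ⊗[k] DualAlg k H) (h : H) :
    invTensorHom k H A (Smash.lmulDual p x) h =
      LinearMap.mul' k A (TensorProduct.map (invTensorHom k H A x)
        (Algebra.linearMap k A ∘ₗ DualAlg.of.symm p ∘ₗ antipodeInv k) (comul h)) := by
  induction x with
  | zero => simp
  | add x y hx hy =>
    simp only [map_add, LinearMap.add_apply, TensorProduct.map_add_left, hx, hy]
  | tmul b q =>
    have h1 : ∀ w : A ⊗[k] H, (DualAlg.hit p).lTensor A w * ((1 : A) ⊗ₜ[k] q) =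
        (LinearMap.mulRight k q ∘ₗ DualAlg.hit p).lTensor A w := by
      intro w
      induction w with
      | zero => simp
      | add x y hx hy => simp only [map_add, add_mul, hx, hy]
      | tmul c d => simp
    have h2 : invTensorHom k H A (b ⊗ₜ[k] q) =
        tensorHom k H A ((invHit k H q).lTensor A (coact k H A b)) := rfl
    rw [Smash.lmulDual_tmul, h1, invTensorHom, LinearMap.comp_apply, coactLift_lTensor_coact,
      ← invTensorHom, h2]
    generalize coact k H A b = w
    induction w with
    | zero => simp
    | add x y hx hy =>
      simp only [map_add, LinearMap.add_apply, TensorProduct.map_add_left, hx, hy]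
    | tmul c d =>
      rw [LinearMap.lTensor_tmul, tensorHom_tmul, LinearMap.comp_apply, invHit_hit_mul_comul,
        LinearMap.lTensor_tmul]
      generalize (comul h : H ⊗[k] H) = v
      induction v with
      | zero => simp
      | add x y hx hy => simp only [map_add, add_smul, hx, hy]
      | tmul s t =>
        rw [TensorProduct.map_tmul, TensorProduct.map_tmul, LinearMap.mul'_apply,
          LinearMap.mul'_apply, tensorHom_tmul, LinearMap.comp_apply (Algebra.linearMap k A),
          Algebra.linearMap_apply, ← Algebra.commutes, ← Algebra.smul_def, smul_smul, mul_comm]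

/-- The form attached to 1 # p takes the scalar value p(S⁻¹(h)) at 1 ⊗ h, so the dual-ring product
at 1 ⊗ h is ψ(1 ⊗ h₁) p(S⁻¹(h₂)), with ψ the form of x. This is what `invTensorHom_lmulDual`
computes. -/
theorem smashToLeftDual_one_tmul_mul (p : DualAlg k H) (x : Smash k H A) :
    smashToLeftDual (Smash.tmul 1 p * x) =
      smashToLeftDual (Smash.tmul 1 p) * smashToLeftDual x := by
  refine LeftDual.ext_tmul_one fun h => ?_
  rw [LeftDual.mul_apply_tmul_one, smashToLeftDual_apply, one_mul, Smash.toTensor_one_tmul_mul,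
    invTensorHom_lmulDual]
  generalize (comul h : H ⊗[k] H) = v
  induction v with
  | zero => simp
  | add x y hx hy => simp only [TensorProduct.tmul_add, map_add, hx, hy]
  | tmul s t =>
    rw [contractRight_insert_tmul, smashToLeftDual_apply, one_mul]
    change _ = leftDualOf (invTensorHom k H A x.toTensor)
      (of (_ * coact k H A (invTensorHom k H A (1 ⊗ₜ[k] p) t)))
    rw [invTensorHom_one_tmul, leftDualOf_mul_coact, ← TensorProduct.smul_tmul', smul_mul_assoc,
      ← Algebra.TensorProduct.one_def, one_mul, TensorProduct.map_tmul, LinearMap.mul'_apply, LinearMap.comp_apply,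
      Algebra.linearMap_apply, ← Algebra.commutes, ← Algebra.smul_def, map_smul,
      LinearMap.smul_apply]
    rfl

/-- Additivity reduces to a left factor a # p = (a # 1)(1 # p). The two special cases then suffice
by associativity in both rings. -/
theorem smashToLeftDual_mul (x y : Smash k H A) :
    smashToLeftDual (x * y) = smashToLeftDual x * smashToLeftDual y := by
  induction x using Smash.induction with
  | zero =>
    rw [zero_mul, smashToLeftDual_zero, zero_mul]
  | add u v hu hv => rw [add_mul, smashToLeftDual_add, smashToLeftDual_add, add_mul, hu, hv]
  | tmul a p =>
    rw [Smash.tmul_eq_mul, mul_assoc, smashToLeftDual_tmul_one_mul, smashToLeftDual_one_tmul_mul,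
      smashToLeftDual_tmul_one_mul, mul_assoc]

variable (k H A) in
/-- The ring isomorphism `A # H* ≃ *(A ⊗ H)`. -/
noncomputable def smashLeftDualEquiv : Smash k H A ≃+* LeftDual A (TensorCoring k H A) :=
  RingEquiv.mk (Equiv.ofBijective _ smashToLeftDual_bijective) smashToLeftDual_mul
    smashToLeftDual_add

end LeftDualEquiv

end HopfCoring

/-! ### The proposition -/

theorem proposition1p2 {k H A : Type*} [CommRing k] [Ring H] [HopfAlgebra k H]
    [Module.Finite k H] [Module.Projective k H] [Ring A] [Algebra k A]
    [ComoduleAlgebra k H A] :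
    ∃ Sinv : H →ₗ[k] H,
      (∀ h, Sinv (HopfAlgebra.antipode k h) = h) ∧
      (∀ h, HopfAlgebra.antipode k (Sinv h) = h) ∧
      ∃ (α : LeftDual A (TensorCoring k H A) ≃+* RightDual A (TensorCoring k H A))
        (γ : RightDual A (TensorCoring k H A) ≃+* BigSmash k H A)
        (e : BigSmash k H A ≃+* Smash k H A),
        -- the isomorphism `(A ⊗ H)* ≃ #(H, A)` and its inverse
        (∀ (φ : RightDual A (TensorCoring k H A)) (h : H),
          (γ φ) h = φ (TensorCoring.tmul 1 (Sinv h))) ∧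
        (∀ (ζ : BigSmash k H A) (a : A) (h : H) (n : ℕ) (x : Fin n → A) (y : Fin n → H),
          coact k H A a = ∑ i, x i ⊗ₜ[k] y i →
          (γ.symm ζ) (TensorCoring.tmul a h) =
            ∑ i, ζ (y i * HopfAlgebra.antipode k h) * x i) ∧
        -- the isomorphism `#(H, A) ≃ A # H*` and its inverse
        (∀ (n : ℕ) (b : Fin n → H) (p : Fin n → (H →ₗ[k] k)),
          (∀ h, ∑ i, p i h • b i = h) →
          ∀ f : BigSmash k H A, e f = ∑ i, Smash.tmul (f (b i)) (DualAlg.of (p i))) ∧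
        (∀ (a : A) (p : H →ₗ[k] k) (h : H),
          (e.symm (Smash.tmul a (DualAlg.of p))) h = p h • a) ∧
        -- the composite isomorphism `A # H* ≃ *(A ⊗ H)`
        (∀ (a : A) (p : H →ₗ[k] k) (n : ℕ) (x : Fin n → A) (y : Fin n → H),
          coact k H A a = ∑ i, x i ⊗ₜ[k] y i →
          ∀ (b : A) (h : H),
            (((α.trans γ).trans e).symm (Smash.tmul a (DualAlg.of p))) (TensorCoring.tmul b h) =
              ∑ i, p (Sinv (h * y i)) • (b * x i)) := by
  -- α is the inverse of A # H* ≃ *(A ⊗ H) followed by A # H* ≃ #(H, A) and γ⁻¹. In the composite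
  -- with γ and e everything but the first factor cancels, so (3) is the formula for
  -- `smashToLeftDual`. The Sweedler sums are obtained by substituting the given expression of the
  -- coaction of a.
  refine ⟨antipodeInv k, antipodeInv_antipode, antipode_antipodeInv,
    (smashLeftDualEquiv k H A).symm.trans
      ((smashEquiv k H A).trans (rightDualEquiv k H A).symm),
    rightDualEquiv k H A, (smashEquiv k H A).symm, fun φ h => rfl, ?_,
    fun n b p hp f => smashEquiv_symm_eq_sum hp f, fun a p h => rfl, ?_⟩
  · intro ζ a h n x y hxy
    change twistₗ ζ.toLin (HopfAlgebra.antipode k h) (coact k H A a) = _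
    rw [hxy, map_sum]
    rfl
  · intro a p n x y hxy b h
    rw [show (((((smashLeftDualEquiv k H A).symm.trans
      ((smashEquiv k H A).trans (rightDualEquiv k H A).symm)).trans
        (rightDualEquiv k H A)).trans (smashEquiv k H A).symm).symm
          (Smash.tmul a (DualAlg.of p))) = smashToLeftDual (Smash.tmul a (DualAlg.of p)) by
      rw [RingEquiv.symm_apply_eq]
      simp only [RingEquiv.trans_apply, RingEquiv.apply_symm_apply, RingEquiv.symm_apply_apply]
      exact ((smashLeftDualEquiv k H A).symm_apply_apply _).symm]
    refine (leftDualOf_tmul _ b h).trans ?_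
    change b * tensorHom k H A ((invHit k H _).lTensor A (coact k H A a)) h = _
    rw [hxy]
    simp only [map_sum, LinearMap.lTensor_tmul, LinearMap.sum_apply, tensorHom_tmul,
      Finset.mul_sum, mul_smul_comm]
    rfl
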